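/- Let $T$ be a complete first-order theory, $\mathbb{M}$ a sufficiently saturated model of $T$ ($\kappa$-saturated for some $\kappa>|L|+\aleph_0$; "small" means of size less than $\kappa$), and $M\prec\mathbb{M}$ a small elementary submodel. A global type $p(x)$ (a complete type over $\mathbb{M}$) is $M$-invariant if for every formula $\varphi(x,y)$ without parameters, whether $\varphi(x,c)\in p$ depends only on $\mathrm{tp}(c/M)$. A sequence $(b_i)_{i<\omega}$ is an invariant Morley sequence over $M$ if there is an $M$-invariant global type $p$ with $b_i\models p|_{M\{b_j : j<i\}}$ for all $i<\omega$. A formula $\varphi(x,b)$ Conant-divides over $M$ if for every invariant Morley sequence $(b_i)_{i<\omega}$ over $M$ with $b_0=b$ the set $\{\varphi(x,b_i)\}_{i<\omega}$ is inconsistent; it Conant-forks over $M$ if it implies a finite disjunction of formulas (with parameters in $\mathbb{M}$) that Conant-divide over $M$. For small sets $A,B\subseteq\mathbb{M}$, $A$ is Conant-independent from $B$ over $M$ if $\mathrm{tp}(A/MB)$ contains no formula that Conant-forks over $M$. Conant-independence is symmetric in $T$ if, for all such $M$, $A$, $B$ (in every sufficiently saturated model of $T$), $A$ is Conant-independent from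 $B$ over $M$ if and only if $B$ is Conant-independent from $A$ over $M$. For $n\ge 3$, $T$ is $\mathrm{NSOP}_n$ if there is no definable relation $R(x_1,x_2)$ between tuples of the same finite length which has no $n$-cycles (no $c_1,\dots,c_n$ with $R(c_1,c_2),\dots,R(c_{n-1},c_n),R(c_n,c_1)$) but for which there are tuples $(a_i)_{i<\omega}$ with $R(a_i,a_j)$ for all $i<j$; $\mathrm{NSOP}_1$ and $\mathrm{NSOP}_2$ are defined as usual, by the absence of the corresponding trees $(b_\eta)_{\eta\in 2^{<\omega}}$. For $n\ge 2$, $T$ is strictly $\mathrm{NSOP}_n$ if it is $\mathrm{NSOP}_n$ but not $\mathrm{NSOP}_{n-1}$. **Theorem.** Every complete theory in which Conant-independence is symmetric is $\mathrm{NSOP}_4$. Moreover, $n=4$ is the greatest $n$ for which there is a strictly $\mathrm{NSOP}_n$ theory with symmetric Conant-independence; in particular, such a theory exists for $n=4$. -/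

import Mathlib

universe u v

open FirstOrder FirstOrder.Language Cardinal

namespace ConantIndependence

/-! Throughout, tuples are indexed by `Fin n`, and a formula `φ(x, y)` with `x` an `n`-tuple and
`y` a `k`-tuple of variables is an element of `L.Formula (Fin n ⊕ Fin k)`. -/

section Types

variable {L : FirstOrder.Language.{u, v}} {N : Type (max u v)} [L.Structure N]

/-- The formula `φ(x, c)` with parameters `c` in `N`, as a formula in the language `L[[N]]`. -/
def withParams {n k : ℕ} (φ : L.Formula (Fin n ⊕ Fin k)) (c : Fin k → N) :
    L[[N]].Formula (Fin n) :=
  BoundedFormula.constantsVarsEquiv.symm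
    (Formula.relabel (Sum.elim Sum.inr (fun j => Sum.inl (c j))) φ : L.Formula (N ⊕ Fin n))

/-- `φ(x, c)` has the expected meaning. -/
theorem realize_withParams {n k : ℕ} (φ : L.Formula (Fin n ⊕ Fin k)) (c : Fin k → N)
    (a : Fin n → N) : (withParams φ c).Realize a ↔ φ.Realize (Sum.elim a c) := by
  unfold Formula.Realize
  rw [← BoundedFormula.realize_constantsVarsEquiv, withParams, Equiv.apply_symm_apply]
  refine Iff.trans (Formula.realize_relabel (φ := φ)) ?_
  unfold Formula.Realize
  have : (Sum.elim (fun a : N => ((L.con a : L[[N]].Constants) : N)) a ∘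
      Sum.elim Sum.inr fun j => Sum.inl (c j)) = Sum.elim a c := by
    funext x
    rcases x with x | x <;> rfl
  rw [this]

variable [Nonempty N]

/-- The (complete) type of the tuple `b` over the set `A` of parameters. -/
def typeOver (A : Set N) {n : ℕ} (b : Fin n → N) :
    (L[[A]].completeTheory N).CompleteType (Fin n) :=
  (L[[A]].completeTheory N).typeOf b

variable (L N) in
/-- `N` is `κ`-saturated: every complete type in finitely many variables over a set of fewer than
`κ` parameters from `N` is realized in `N`. -/
def IsSaturated (κ : Cardinal.{max u v}) : Prop :=
  ∀ A : Set N, #A < κ → ∀ (n : ℕ) (p : (L[[A]].completeTheory N).CompleteType (Fin n)),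
    ∃ b : Fin n → N, typeOver A b = p

variable (L N) in
/-- Complete types in `n` variables over the whole structure `N` (used with `N` a sufficiently
saturated model, where they are called global types). -/
abbrev GlobalType (n : ℕ) : Type (max u v) :=
  (L.elementaryDiagram N).CompleteType (Fin n)

/-- The formula `φ(x, c)` belongs to the global type `p(x)`. -/
def GlobalType.HasFormula {n k : ℕ} (p : GlobalType L N n) (φ : L.Formula (Fin n ⊕ Fin k))
    (c : Fin k → N) : Prop :=
  Formula.equivSentence (withParams φ c) ∈ p

/-- The global type `p` is invariant over `M`: whether `φ(x, c)` belongs to `p` depends only on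
`φ` and on the type of `c` over `M`. -/
def GlobalType.IsInvariant {n : ℕ} (p : GlobalType L N n) (M : L.ElementarySubstructure N) :
    Prop :=
  ∀ (k : ℕ) (φ : L.Formula (Fin n ⊕ Fin k)) (c d : Fin k → N),
    typeOver (L := L) (M : Set N) c = typeOver (M : Set N) d →
      (p.HasFormula φ c ↔ p.HasFormula φ d)

/-- The tuple `a` realizes the restriction of the global type `p` to the set `A`. -/
def GlobalType.RealizesOver {n : ℕ} (p : GlobalType L N n) (A : Set N) (a : Fin n → N) : Prop :=
  ∀ (k : ℕ) (φ : L.Formula (Fin n ⊕ Fin k)) (c : Fin k → N),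
    (∀ j, c j ∈ A) → p.HasFormula φ c → φ.Realize (Sum.elim a c)

/-- The sequence `(s i)` of `n`-tuples is an invariant Morley sequence over `M`: for some global
type `p` invariant over `M`, each `s i` realizes the restriction of `p` to `M` together with the
`s j` for `j < i`. -/
def IsInvariantMorleySequence (M : L.ElementarySubstructure N) {n : ℕ} (s : ℕ → Fin n → N) :
    Prop :=
  ∃ p : GlobalType L N n, p.IsInvariant M ∧
    ∀ i, p.RealizesOver ((M : Set N) ∪ {y | ∃ j < i, ∃ t, y = s j t}) (s i)

/-- `φ(x, b)` Conant-divides over `M`: for every invariant Morley sequence `(s i)` over `M`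
starting with `b`, the set `{φ(x, s i) : i < ω}` is inconsistent, that is, some finite subset of
it is not satisfiable in the model. -/
def ConantDivides (M : L.ElementarySubstructure N) {n k : ℕ} (φ : L.Formula (Fin n ⊕ Fin k))
    (b : Fin k → N) : Prop :=
  ∀ s : ℕ → Fin k → N, IsInvariantMorleySequence (L := L) M s → s 0 = b →
    ∃ F : Finset ℕ, ¬ ∃ a : Fin n → N, ∀ i ∈ F, φ.Realize (Sum.elim a (s i))

/-- `φ(x, b)` Conant-forks over `M`: it implies a finite disjunction of formulas `ψ_j(x, c_j)`,
each of which Conant-divides over `M`. -/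
def ConantForks (M : L.ElementarySubstructure N) {n k : ℕ} (φ : L.Formula (Fin n ⊕ Fin k))
    (b : Fin k → N) : Prop :=
  ∃ (m : ℕ) (l : Fin m → ℕ) (ψ : (j : Fin m) → L.Formula (Fin n ⊕ Fin (l j)))
    (c : (j : Fin m) → Fin (l j) → N),
    (∀ j, ConantDivides M (ψ j) (c j)) ∧
      ∀ a : Fin n → N, φ.Realize (Sum.elim a b) → ∃ j, (ψ j).Realize (Sum.elim a (c j))

/-- `A` is Conant-independent from `B` over `M`: the type of `A` over `M ∪ B` contains no formula
that Conant-forks over `M`. -/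
def ConantIndep (M : L.ElementarySubstructure N) (A B : Set N) : Prop :=
  ∀ (n k : ℕ) (φ : L.Formula (Fin n ⊕ Fin k)) (a : Fin n → N) (c : Fin k → N),
    (∀ i, a i ∈ A) → (∀ j, c j ∈ (M : Set N) ∪ B) →
      φ.Realize (Sum.elim a c) → ¬ ConantForks M φ c

end Types

/-- Conant-independence is symmetric in `T`: in every model `N` of `T` which is `κ`-saturated for
some `κ > |L| + ℵ₀`, it is a symmetric relation between small sets over small elementary
submodels, where small means of size less than `κ`. -/
def HasSymmetricConantIndependence {L : FirstOrder.Language.{u, v}} (T : L.Theory) : Prop :=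
  ∀ (N : Theory.ModelType.{u, v, max u v} T) (κ : Cardinal.{max u v}),
    max L.card ℵ₀ < κ → IsSaturated L N κ →
      ∀ M : L.ElementarySubstructure N, #M < κ →
        ∀ A B : Set N, #A < κ → #B < κ → ConantIndep M A B → ConantIndep M B A

/-- A set of formulas `{φ(x, b) : b ∈ S}` is consistent (finitely satisfiable in `N`). -/
def ConsistentInstances {L : FirstOrder.Language.{u, v}} {N : Type (max u v)} [L.Structure N] {n k : ℕ}
    (φ : L.Formula (Fin n ⊕ Fin k)) (S : Set (Fin k → N)) : Prop :=
  ∀ F : Finset (Fin k → N), (F : Set (Fin k → N)) ⊆ S →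
    ∃ a : Fin n → N, ∀ b ∈ F, φ.Realize (Sum.elim a b)

/-- `T` has `SOP₁`. Finite binary sequences are lists, `<+:` is the initial segment relation. -/
def HasSOPOne {L : FirstOrder.Language.{u, v}} (T : L.Theory) : Prop :=
  ∃ (N : Theory.ModelType.{u, v, max u v} T) (n k : ℕ) (φ : L.Formula (Fin n ⊕ Fin k))
    (b : List Bool → Fin k → N),
    (∀ σ : ℕ → Bool,
      ConsistentInstances φ (Set.range fun m : ℕ => b (List.ofFn fun i : Fin m => σ i))) ∧
    ∀ η₁ η₂ : List Bool, (η₁ ++ [false]) <+: η₂ →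
      ¬ ConsistentInstances φ {b η₂, b (η₁ ++ [true])}

/-- `T` has `SOP₂`. -/
def HasSOPTwo {L : FirstOrder.Language.{u, v}} (T : L.Theory) : Prop :=
  ∃ (N : Theory.ModelType.{u, v, max u v} T) (n k : ℕ) (φ : L.Formula (Fin n ⊕ Fin k))
    (b : List Bool → Fin k → N),
    (∀ σ : ℕ → Bool,
      ConsistentInstances φ (Set.range fun m : ℕ => b (List.ofFn fun i : Fin m => σ i))) ∧
    ∀ η₁ η₂ : List Bool, ¬ η₁ <+: η₂ → ¬ η₂ <+: η₁ →
      ¬ ConsistentInstances φ {b η₁, b η₂}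

/-- For `n = m + 3`: there are a definable relation `R(x₁, x₂)` between tuples of the same length
without `n`-cycles and tuples `a i`, `i < ω`, with `R(a i, a j)` for all `i < j`. Addition on
`Fin (m + 3)` is modulo `m + 3`. -/
def HasSOPAddThree {L : FirstOrder.Language.{u, v}} (T : L.Theory) (m : ℕ) : Prop :=
  ∃ (N : Theory.ModelType.{u, v, max u v} T) (k : ℕ) (R : L.Formula (Fin k ⊕ Fin k)),
    (¬ ∃ x : Fin (m + 3) → Fin k → N, ∀ i, R.Realize (Sum.elim (x i) (x (i + 1)))) ∧
    ∃ a : ℕ → Fin k → N, ∀ i j, i < j → R.Realize (Sum.elim (a i) (a j))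

/-- The (complete) theory `T` has `SOP_n`, for `n ≥ 1` (there is no `SOP_0`). -/
def HasSOP {L : FirstOrder.Language.{u, v}} (T : L.Theory) : ℕ → Prop
  | 0 => False
  | 1 => HasSOPOne T
  | 2 => HasSOPTwo T
  | m + 3 => HasSOPAddThree T m

/-- `T` is `NSOP_n`. -/
def IsNSOP {L : FirstOrder.Language.{u, v}} (T : L.Theory) (n : ℕ) : Prop :=
  ¬ HasSOP T n

/-- `T` is strictly `NSOP_n`, for `n ≥ 2`: it is `NSOP_n` but not `NSOP_{n-1}`. -/
def IsStrictlyNSOP {L : FirstOrder.Language.{u, v}} (T : L.Theory) (n : ℕ) : Prop :=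
  2 ≤ n ∧ IsNSOP T n ∧ ¬ IsNSOP T (n - 1)

end ConantIndependence

/-!
Throughout, global types over a model `N` are handled as limits of ultrafilters on tuples of `N`
(`GlobalType.exists_ultrafilter`), and small types are realized by saturation.

**Symmetry implies `NSOP₄`** (`isNSOP_four_of_symmetric`). Suppose `R` has no `4`-cycle, but there is
an infinite chain `R(a i, a j)`, `i < j`. Pass to a saturated elementary extension
(`exists_saturated_extension`), choose a small elementary substructure `M` containing the chain, and
let `s 0, …, s 4` realize successively, over `M` and the earlier terms, the limit of the `a i` along
a nonprincipal ultrafilter. This limit is finitely satisfiable in `M`, and `R(s j, s i)` holds for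
`i < j`. A tuple whose type over `M ∪ A ∪ B` is finitely satisfiable in `M` may be added to the left
side of a pair `A`, `B` of independent sets (`ConantIndep.union_range`). Adding the `s i` one at a
time and exchanging the sides by symmetry after each step, one finds that `s 1, s 3` are independent
from `s 0, s 2, s 4`. Hence the formula in `(x, x')` describing the path
`s 4 → x → s 2 → x' → s 0` does not Conant-divide over `M`, and it is consistent along an invariant
Morley sequence starting with `(s 4, s 2, s 0)`. If `(y₁, z₁, w₁)` is the second term of that
sequence, this gives `s 4 → x → z₁` and `z₁ → x' → s 0`. As `s 4` and `s 0` have the same type over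
`M`, invariance turns the second path into a path `z₁ → x'' → s 4`, which closes a `4`-cycle
(`exists_four_cycle_of_conantIndep`).

**Maximality of `4`.** If `R` has an infinite chain and no `n + 1`-cycle, then the relation
`R(x, y) ∧ ∃ z, R(x, z) ∧ R(z, y)` has an infinite chain and no `n`-cycle. So `SOP_n` for some
`n ≥ 4` implies `SOP₄` (`HasSOPAddThree.of_le`), and no theory with symmetric Conant-independence is
strictly `NSOP_n` with `n ≥ 5`.

**The example** is the theory of the Henson graph, the generic triangle-free graph. All models are
generic triangle-free graphs (`isGeneric_of_models`), which have quantifier elimination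
(`IsGeneric.realize_iff`). For such a graph, `A` is Conant-independent from `B` over `M` if and only
if `A ∩ B ⊆ M`, which is a symmetric condition. Necessity holds in every theory
(`ConantIndep.mem_of_mem`). For sufficiency, every tuple starts a Morley sequence which is freely
amalgamated over `M` (`IsGeneric.exists_freeSequence`), and free amalgamation yields a common
solution of the instances along this sequence of any formula with a solution disjoint from its
parameters outside `M` (`IsFreeSequence.exists_amalgam`). The theory has `SOP₃`, by the relation
between triples that joins `x i` to `y (i + 1)` for all `i` modulo `3`
(`hasSOPAddThree_hensonTheory`).
-/

open Filter

namespace ConantIndependence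

/-! ### Ultrafilters and types -/

section UltrafilterTypes

universe u' v' w

/-- A family of sets with the finite intersection property is contained in an ultrafilter. -/
theorem exists_ultrafilter_of_finite_inter {X ι : Type*} (S : ι → Set X)
    (h : ∀ F : Finset ι, ∃ x, ∀ i ∈ F, x ∈ S i) : ∃ U : Ultrafilter X, ∀ i, S i ∈ U := by
  classical
  have hne : (generate (Set.range S)).NeBot := by
    rw [generate_neBot_iff]
    intro t htB htf
    have := htf.to_subtype
    choose f hf using fun s : t => htB s.2
    obtain ⟨x, hx⟩ := h (Set.finite_range f).toFinset
    refine ⟨x, fun s hs => ?_⟩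
    have h1 := hx (f ⟨s, hs⟩) (by simp)
    rwa [hf ⟨s, hs⟩] at h1
  exact ⟨Ultrafilter.of _, fun i =>
    Ultrafilter.of_le (generate (Set.range S)) (mem_generate_of_mem ⟨i, rfl⟩)⟩

theorem realize_iExs_relabel_inr {L' : FirstOrder.Language.{u', v'}} {β : Type*} [Finite β]
    (φ : L'.Formula β) (K : Type*) [L'.Structure K] :
    K ⊨ (Formula.iExs β (φ.relabel (Sum.inr : β → Empty ⊕ β)) : L'.Sentence) ↔
      ∃ a : β → K, φ.Realize a := by
  unfold Sentence.Realize
  rw [Formula.realize_iExs]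
  simp only [Formula.realize_relabel, Function.comp_def, Sum.elim_inr]

/-- A formula in finitely many variables satisfiable in `M` is satisfiable in every structure
elementarily equivalent to `M`. -/
theorem exists_realize_of_elementarilyEquivalent {L' : FirstOrder.Language.{u', v'}} {M N : Type*}
    [L'.Structure M] [L'.Structure N] (h : M ≅[L'] N) {β : Type*} [Finite β] (φ : L'.Formula β)
    (hφ : ∃ a : β → M, φ.Realize a) : ∃ b : β → N, φ.Realize b :=
  (realize_iExs_relabel_inr φ N).1
    ((h.realize_sentence _).1 ((realize_iExs_relabel_inr φ M).2 hφ))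

/-- An ultrapower of a model of `T'` is a model of `T'`. -/
instance ultrapower_models {L' : FirstOrder.Language.{u', v'}} {N : Type w} [L'.Structure N]
    [Nonempty N] (T' : L'.Theory) [N ⊨ T'] {ι : Type*} (U : Ultrafilter ι) :
    (U : Filter ι).Product (fun _ => N) ⊨ T' := by
  refine ⟨fun φ hφ => ?_⟩
  rw [Ultraproduct.sentence_realize]
  exact Eventually.of_forall fun _ => Theory.realize_sentence_of_mem T' hφ

/-- The complete type, over any theory `T'` true in `N`, of all formulas that hold at `U`-almost
every tuple: the type of the diagonal tuple in the ultrapower of `N` modulo `U`. -/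
noncomputable def limitType {L' : FirstOrder.Language.{u', v'}} {N : Type w} [L'.Structure N]
    [Nonempty N] (T' : L'.Theory) [N ⊨ T'] {α : Type} (U : Ultrafilter (α → N)) :
    T'.CompleteType α :=
  T'.typeOf (M := (U : Filter (α → N)).Product (fun _ => N)) fun i =>
    ((fun a : α → N => a i) : (U : Filter (α → N)).Product (fun _ => N))

theorem mem_limitType {L' : FirstOrder.Language.{u', v'}} {N : Type w} [L'.Structure N]
    [Nonempty N] (T' : L'.Theory) [N ⊨ T'] {α : Type} (U : Ultrafilter (α → N))
    (φ : L'.Formula α) :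
    Formula.equivSentence φ ∈ limitType T' U ↔ ∀ᶠ a in (U : Filter (α → N)), φ.Realize a := by
  refine Iff.trans (Theory.CompleteType.formula_mem_typeOf (T := T')) ?_
  exact Ultraproduct.realize_formula_cast φ (fun (i : α) (a : α → N) => a i)

/-- Every complete type over the full theory of `N` is the limit of an ultrafilter on tuples. -/
theorem exists_ultrafilter_of_completeType {L' : FirstOrder.Language.{u', v'}} {N : Type w}
    [L'.Structure N] [Nonempty N] {α : Type} [Finite α]
    (p : (L'.completeTheory N).CompleteType α) :
    ∃ U : Ultrafilter (α → N), ∀ φ : L'.Formula α,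
      Formula.equivSentence φ ∈ p ↔ ∀ᶠ a in (U : Filter (α → N)), φ.Realize a := by
  obtain ⟨K, b, hb⟩ := Theory.exists_modelType_is_realized_in _ p
  have hp : ∀ φ : L'.Formula α, Formula.equivSentence φ ∈ p ↔ φ.Realize b := by
    intro φ
    rw [← hb, Theory.CompleteType.formula_mem_typeOf]
  have hmain : ∀ F : Finset {φ : L'.Formula α // φ.Realize b},
      ∃ a : α → N, ∀ φ ∈ F, a ∈ {a : α → N | φ.1.Realize a} := by
    intro F
    have h : (K : Type _) ≅[L'] N := by
      have := Theory.IsComplete.eq_complete_theory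
        (completeTheory.isComplete L' N) K
      exact this.symm.trans (Theory.IsComplete.eq_complete_theory
        (completeTheory.isComplete L' N) N)
    obtain ⟨a, ha⟩ := exists_realize_of_elementarilyEquivalent h
      (Formula.iInf fun φ : F => φ.1.1) ⟨b, by rw [Formula.realize_iInf]; exact fun φ => φ.1.2⟩
    rw [Formula.realize_iInf] at ha
    exact ⟨a, fun φ hφ => ha ⟨φ, hφ⟩⟩
  obtain ⟨U, hU⟩ := exists_ultrafilter_of_finite_inter
    (fun φ : {φ : L'.Formula α // φ.Realize b} => {a : α → N | φ.1.Realize a}) hmain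
  have key : ∀ φ : L'.Formula α, φ.Realize b → ∀ᶠ a in (U : Filter (α → N)), φ.Realize a :=
    fun φ hφ => hU ⟨φ, hφ⟩
  refine ⟨U, fun φ => ?_⟩
  rw [hp]
  refine ⟨key φ, fun h => ?_⟩
  by_contra hn
  have h2 := key φ.not (by rwa [Formula.realize_not])
  obtain ⟨a, h3, h4⟩ := (h.and h2).exists
  exact (Formula.realize_not.1 h4) h3

end UltrafilterTypes

section Types

variable {L : FirstOrder.Language.{u, v}} {N : Type (max u v)} [L.Structure N] [Nonempty N]

/-- Two tuples have the same type over `A` if and only if they satisfy the same formulas with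
parameters in `A`. -/
theorem typeOver_eq_iff {A : Set N} {n : ℕ} {b b' : Fin n → N} :
    typeOver (L := L) A b = typeOver A b' ↔
      ∀ φ : L.Formula (A ⊕ Fin n),
        φ.Realize (Sum.elim (↑) b) ↔ φ.Realize (Sum.elim (↑) b') := by
  have key : ∀ (ψ : L[[A]].Formula (Fin n)) (a : Fin n → N),
      ψ.Realize a ↔ Formula.Realize (BoundedFormula.constantsVarsEquiv ψ : L.Formula (A ⊕ Fin n))
        (Sum.elim (↑) a) := by
    intro ψ a
    unfold Formula.Realize
    rw [← BoundedFormula.realize_constantsVarsEquiv]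
    rfl
  constructor
  · intro h φ
    have := Theory.CompleteType.formula_mem_typeOf (T := L[[A]].completeTheory N) (v := b)
      (φ := (BoundedFormula.constantsVarsEquiv.symm φ : L[[A]].Formula (Fin n)))
    have h' := Theory.CompleteType.formula_mem_typeOf (T := L[[A]].completeTheory N) (v := b')
      (φ := (BoundedFormula.constantsVarsEquiv.symm φ : L[[A]].Formula (Fin n)))
    unfold typeOver at h
    rw [h, h', key, key, Equiv.apply_symm_apply] at this
    exact this.symm
  · intro h
    refine SetLike.ext fun ψ => ?_
    unfold typeOver
    rw [Theory.CompleteType.mem_typeOf, Theory.CompleteType.mem_typeOf, key, key]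
    exact h _

theorem realize_iff_of_typeOver_eq {A : Set N} {n k : ℕ} {b b' : Fin n → N}
    (h : typeOver (L := L) A b = typeOver A b') (φ : L.Formula (Fin n ⊕ Fin k)) {c : Fin k → N}
    (hc : ∀ j, c j ∈ A) : φ.Realize (Sum.elim b c) ↔ φ.Realize (Sum.elim b' c) := by
  have := typeOver_eq_iff.1 h
    (φ.relabel (Sum.elim Sum.inr fun j => Sum.inl (⟨c j, hc j⟩ : A)))
  simp only [Formula.realize_relabel] at this
  have e : ∀ x : Fin n → N, (Sum.elim (fun y : A => (y : N)) x ∘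
      Sum.elim Sum.inr fun j => Sum.inl (⟨c j, hc j⟩ : A)) = Sum.elim x c := by
    intro x
    funext y
    rcases y with y | y <;> rfl
  rwa [e, e] at this

/-- The global type of all formulas that hold at `U`-almost every tuple. -/
noncomputable def globalLimit {n : ℕ} (U : Ultrafilter (Fin n → N)) : GlobalType L N n :=
  limitType (L.elementaryDiagram N) U

theorem globalLimit_hasFormula {n k : ℕ} (U : Ultrafilter (Fin n → N))
    (φ : L.Formula (Fin n ⊕ Fin k)) (c : Fin k → N) :
    (globalLimit U : GlobalType L N n).HasFormula φ c ↔
      ∀ᶠ a in (U : Filter (Fin n → N)), φ.Realize (Sum.elim a c) := by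
  unfold GlobalType.HasFormula globalLimit
  rw [mem_limitType]
  simp only [realize_withParams]

/-- Every global type is the limit of an ultrafilter on tuples. -/
theorem GlobalType.exists_ultrafilter {n : ℕ} (p : GlobalType L N n) :
    ∃ U : Ultrafilter (Fin n → N), ∀ (k : ℕ) (φ : L.Formula (Fin n ⊕ Fin k)) (c : Fin k → N),
      p.HasFormula φ c ↔ ∀ᶠ a in (U : Filter (Fin n → N)), φ.Realize (Sum.elim a c) := by
  obtain ⟨U, hU⟩ := exists_ultrafilter_of_completeType (L' := L[[N]]) (N := N) p
  refine ⟨U, fun k φ c => ?_⟩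
  unfold GlobalType.HasFormula
  rw [hU]
  simp only [realize_withParams]

/-- The tuple `a` realizes the limit of the ultrafilter `U` over the set `A`. Formulas are allowed
to use `A` itself as their set of parameter variables. -/
def RealizesLimit (L : FirstOrder.Language.{u, v}) {N : Type (max u v)} [L.Structure N] {n : ℕ}
    (U : Ultrafilter (Fin n → N)) (A : Set N) (a : Fin n → N) : Prop :=
  ∀ φ : L.Formula (A ⊕ Fin n), φ.Realize (Sum.elim (↑) a) ↔
    ∀ᶠ x in (U : Filter (Fin n → N)), φ.Realize (Sum.elim (↑) x)

omit [Nonempty N] in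
theorem RealizesLimit.realize_iff {n k : ℕ} {U : Ultrafilter (Fin n → N)} {A : Set N}
    {a : Fin n → N} (h : RealizesLimit L U A a) (φ : L.Formula (Fin n ⊕ Fin k)) {c : Fin k → N}
    (hc : ∀ j, c j ∈ A) :
    φ.Realize (Sum.elim a c) ↔ ∀ᶠ x in (U : Filter (Fin n → N)), φ.Realize (Sum.elim x c) := by
  have := h (φ.relabel (Sum.elim Sum.inr fun j => Sum.inl (⟨c j, hc j⟩ : A)))
  simp only [Formula.realize_relabel] at this
  have e : ∀ x : Fin n → N, (Sum.elim (fun y : A => (y : N)) x ∘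
      Sum.elim Sum.inr fun j => Sum.inl (⟨c j, hc j⟩ : A)) = Sum.elim x c := by
    intro x
    funext y
    rcases y with y | y <;> rfl
  simpa only [e] using this

omit [Nonempty N] in
theorem RealizesLimit.mono {n : ℕ} {U : Ultrafilter (Fin n → N)} {A B : Set N}
    {a : Fin n → N} (h : RealizesLimit L U B a) (hAB : A ⊆ B) : RealizesLimit L U A a := by
  intro φ
  have := h (φ.relabel (Sum.map (Set.inclusion hAB) id))
  simp only [Formula.realize_relabel] at this
  have e : ∀ x : Fin n → N, (Sum.elim (fun y : B => (y : N)) x ∘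
      Sum.map (Set.inclusion hAB) id) = Sum.elim (fun y : A => (y : N)) x := by
    intro x
    funext y
    rcases y with y | y <;> rfl
  simpa only [e] using this

theorem RealizesLimit.typeOver_eq {n : ℕ} {U : Ultrafilter (Fin n → N)} {A : Set N}
    {a b : Fin n → N} (ha : RealizesLimit L U A a) (hb : RealizesLimit L U A b) :
    typeOver (L := L) A a = typeOver A b :=
  typeOver_eq_iff.2 fun φ => (ha φ).trans (hb φ).symm

/-- In a `κ`-saturated structure the limit of an ultrafilter is realized over every set of
parameters of size less than `κ`. -/
theorem IsSaturated.exists_realizesLimit {κ : Cardinal.{max u v}} (hN : IsSaturated L N κ)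
    {n : ℕ} (U : Ultrafilter (Fin n → N)) {A : Set N} (hA : #A < κ) :
    ∃ a, RealizesLimit L U A a := by
  obtain ⟨a, ha⟩ := hN A hA n (limitType (L[[A]].completeTheory N) U)
  refine ⟨a, fun φ => ?_⟩
  have h1 := Theory.CompleteType.formula_mem_typeOf (T := L[[A]].completeTheory N) (v := a)
    (φ := (BoundedFormula.constantsVarsEquiv.symm φ : L[[A]].Formula (Fin n)))
  have h2 := mem_limitType (L[[A]].completeTheory N) U
    (BoundedFormula.constantsVarsEquiv.symm φ : L[[A]].Formula (Fin n))
  unfold typeOver at ha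
  rw [ha, h2] at h1
  have key : ∀ x : Fin n → N, Formula.Realize (BoundedFormula.constantsVarsEquiv.symm φ :
      L[[A]].Formula (Fin n)) x ↔ φ.Realize (Sum.elim (↑) x) := by
    intro x
    unfold Formula.Realize
    rw [← BoundedFormula.realize_constantsVarsEquiv, Equiv.apply_symm_apply]
    rfl
  simpa only [key] using h1.symm

end Types

/-! ### Saturated elementary extensions -/

section Saturation

variable {L : FirstOrder.Language.{u, v}}

/-- Names for the elements of a saturated extension of `N₀`: a name for every element of `N₀` and,
for every set `p` of formulas in the variables `x₁, …, xₙ` whose parameters, indexed by `I`, already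
have names, names for the coordinates of an `n`-tuple intended to realize `p`. -/
inductive SatName (L : FirstOrder.Language.{u, v}) (N₀ I : Type (max u v)) : Type (max u v)
  | base : N₀ → SatName L N₀ I
  | wit (n : ℕ) (i : Fin n) (p : Set (L.Formula (I ⊕ Fin n))) (c : I → SatName L N₀ I) :
      SatName L N₀ I

/-- The set `p` of formulas over the parameters `c` is finitely satisfiable in `K`. -/
def FinSat {K I : Type (max u v)} [L.Structure K] {n : ℕ} (p : Set (L.Formula (I ⊕ Fin n)))
    (c : I → K) : Prop :=
  ∀ F : Finset (L.Formula (I ⊕ Fin n)), (F : Set (L.Formula (I ⊕ Fin n))) ⊆ p →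
    ∃ b : Fin n → K, ∀ φ ∈ F, φ.Realize (Sum.elim c b)

theorem FinSat.of_realize_iff {K K' I : Type (max u v)} [L.Structure K] [L.Structure K'] {n : ℕ}
    {p : Set (L.Formula (I ⊕ Fin n))} {c : I → K} {c' : I → K'} (h : FinSat p c)
    (hc : ∀ φ : L.Formula I, φ.Realize c ↔ φ.Realize c') : FinSat p c' := by
  intro F hF
  obtain ⟨b, hb⟩ := h F hF
  have h1 : (Formula.iExs (Fin n) (Formula.iInf fun φ : F => φ.1)).Realize c := by
    rw [Formula.realize_iExs]
    exact ⟨b, by rw [Formula.realize_iInf]; exact fun φ => hb φ.1 φ.2⟩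
  rw [hc, Formula.realize_iExs] at h1
  obtain ⟨b', hb'⟩ := h1
  rw [Formula.realize_iInf] at hb'
  exact ⟨b', fun φ hφ => hb' ⟨φ, hφ⟩⟩

/-- A finitely satisfiable set of formulas is realized in an ultrapower. -/
theorem FinSat.exists_extension {K I : Type (max u v)} [L.Structure K] [Nonempty K] {n : ℕ}
    {p : Set (L.Formula (I ⊕ Fin n))} {c : I → K} (h : FinSat p c) :
    ∃ (K' : Type (max u v)) (_ : L.Structure K') (_ : Nonempty K') (j : K → K')
      (b : Fin n → K'), (∀ (φ : L.Formula K), φ.Realize id ↔ φ.Realize j) ∧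
      ∀ φ ∈ p, φ.Realize (Sum.elim (j ∘ c) b) := by
  classical
  have h' : ∀ F : Finset p, ∃ b : Fin n → K, ∀ φ ∈ F, φ.1.Realize (Sum.elim c b) := by
    intro F
    obtain ⟨b, hb⟩ := h (F.image Subtype.val) (by simp)
    exact ⟨b, fun φ hφ => hb _ (Finset.mem_image_of_mem _ hφ)⟩
  choose b hb using h'
  let U : Ultrafilter (Finset p) := Ultrafilter.of atTop
  refine ⟨(U : Filter (Finset p)).Product fun _ => K, inferInstance, inferInstance,
    fun x => ((fun _ => x : Finset p → K) : (U : Filter (Finset p)).Product fun _ => K),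
    fun i => ((fun F => b F i : Finset p → K) : (U : Filter (Finset p)).Product fun _ => K),
    fun φ => ?_, fun φ hφ => ?_⟩
  · refine Iff.trans ?_ (Ultraproduct.realize_formula_cast φ (fun (x : K) (_ : Finset p) => x)).symm
    simp [Function.id_def]
  · have h1 := (Ultraproduct.realize_formula_cast (u := U) φ
      (Sum.elim (fun (i : I) (_ : Finset p) => c i) (fun i F => b F i))).2 (by
        have h2 : ∀ᶠ F in (U : Filter (Finset p)), (⟨φ, hφ⟩ : p) ∈ F :=
          Ultrafilter.of_le atTop ((eventually_ge_atTop {⟨φ, hφ⟩}).mono fun F hF => by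
            simpa using hF)
        refine h2.mono fun F hF => ?_
        have e : (fun i => Sum.elim (fun (i : I) (_ : Finset p) => c i) (fun i F => b F i) i F) =
            Sum.elim c (b F) := by
          funext i; rcases i with i | i <;> rfl
        rw [e]
        exact hb F _ hF)
    refine Eq.mp (congrArg _ (funext fun i => ?_)) h1
    rcases i with i | i <;> rfl

variable {N₀ I : Type (max u v)} [L.Structure N₀]

open SatName

/-- The tuples named by `wit` realize the sets of formulas they are intended to realize, for the
names in `D` and the interpretation `v` of the names. -/
def WitnessesIn {K : Type (max u v)} [L.Structure K] (D : Set (SatName L N₀ I))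
    (v : SatName L N₀ I → K) : Prop :=
  ∀ (n : ℕ) (i : Fin n) (p : Set (L.Formula (I ⊕ Fin n))) (c : I → SatName L N₀ I),
    wit n i p c ∈ D → FinSat p (v ∘ c) →
      ∀ φ ∈ p, φ.Realize (Sum.elim (v ∘ c) fun i' => v (wit n i' p c))

variable (L N₀ I) in
/-- A stage in the construction of a saturated extension of `N₀`: a set of names, closed under
taking the parameters of a name, together with the set of formulas true of the names in some
elementary extension of `N₀`. Recording a set of formulas instead of the extension keeps stages in
the universe of `N₀`. -/
structure Stage where
  /-- The names which have been interpreted. -/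
  dom : Set (SatName L N₀ I)
  /-- The formulas true of the names. -/
  truth : Set (L.Formula (SatName L N₀ I))
  base_mem : ∀ x, base x ∈ dom
  wit_mem : ∀ n i p c, wit n i p c ∈ dom → (∀ j, c j ∈ dom) ∧ ∀ i', wit n i' p c ∈ dom
  spec : ∃ (K : Type (max u v)) (_ : L.Structure K) (_ : Nonempty K) (v : SatName L N₀ I → K),
    (∀ φ, φ ∈ truth ↔ φ.Realize v) ∧
    (∀ φ : L.Formula N₀, φ.Realize (v ∘ base) ↔ φ.Realize id) ∧ WitnessesIn dom v

/-- `X.LE Y`: the stage `Y` interprets more names than `X`, and the same formulas are true of the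
names that `X` interprets. -/
def Stage.LE (X Y : Stage L N₀ I) : Prop :=
  X.dom ⊆ Y.dom ∧ ∀ φ : L.Formula X.dom,
    φ.relabel Subtype.val ∈ X.truth ↔ φ.relabel Subtype.val ∈ Y.truth

theorem Stage.LE.mem_truth_iff {X Y : Stage L N₀ I} (h : X.LE Y) {α : Type*} (φ : L.Formula α)
    {t : α → SatName L N₀ I} (ht : ∀ i, t i ∈ X.dom) :
    φ.relabel t ∈ X.truth ↔ φ.relabel t ∈ Y.truth := by
  have := h.2 (φ.relabel fun i => ⟨t i, ht i⟩)
  obtain ⟨K, _, _, v, hv, -⟩ := X.spec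
  obtain ⟨K', _, _, v', hv', -⟩ := Y.spec
  simp only [hv, hv', Formula.realize_relabel] at this ⊢
  exact this

theorem Stage.LE.trans {X Y Z : Stage L N₀ I} (h : X.LE Y) (h' : Y.LE Z) : X.LE Z :=
  ⟨h.1.trans h'.1, fun φ => (h.2 φ).trans (h'.mem_truth_iff φ fun i => h.1 i.2)⟩

variable (L N₀ I) in
/-- The initial stage, which interprets the names of the elements of `N₀` only. -/
theorem Stage.nonempty [Nonempty N₀] : Nonempty (Stage L N₀ I) := by
  classical
  let v : SatName L N₀ I → N₀ := fun γ => match γ with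
    | base x => x
    | wit _ _ _ _ => Classical.arbitrary N₀
  exact ⟨{ dom := Set.range base
           truth := {φ | φ.Realize v}
           base_mem := fun x => ⟨x, rfl⟩
           wit_mem := by rintro n i p c ⟨x, hx⟩; cases hx
           spec := ⟨N₀, inferInstance, inferInstance, v, fun φ => Iff.rfl, fun φ => Iff.rfl, by
             rintro n i p c ⟨x, hx⟩; cases hx⟩ }⟩

/-- Unions of chains of stages: the union is interpreted in an ultraproduct along the chain. -/
theorem Stage.exists_upper_bound {C : Set (Stage L N₀ I)} (hC : IsChain Stage.LE C)
    (hne : C.Nonempty) : ∃ Y, ∀ X ∈ C, Stage.LE X Y := by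
  classical
  obtain ⟨X₀, hX₀⟩ := hne
  have : Nonempty C := ⟨⟨X₀, hX₀⟩⟩
  let _ : Preorder C :=
    { le := fun X Y => X.1.LE Y.1
      le_refl := fun X => ⟨subset_rfl, fun _ => Iff.rfl⟩
      le_trans := fun X Y Z h h' => h.trans h' }
  have : IsDirectedOrder C := ⟨fun X Y => by
    rcases eq_or_ne X.1 Y.1 with h | h
    · exact ⟨X, le_refl X, by have : X = Y := Subtype.ext h
                              rw [this]⟩
    · rcases hC X.2 Y.2 h with h | h
      · exact ⟨Y, h, le_refl Y⟩
      · exact ⟨X, le_refl X, h⟩⟩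
  let U : Ultrafilter C := Ultrafilter.of atTop
  choose K i₁ i₂ v hv hbase hwit using fun X : C => X.1.spec
  let V : SatName L N₀ I → (U : Filter C).Product K := fun γ =>
    ((fun X => v X γ : ∀ X, K X) : (U : Filter C).Product K)
  have hV : ∀ {α : Type (max u v)} (φ : L.Formula α) (t : α → SatName L N₀ I),
      φ.Realize (V ∘ t) ↔ ∀ᶠ X in (U : Filter C), φ.Realize (v X ∘ t) := fun φ t =>
    Ultraproduct.realize_formula_cast φ fun a X => v X (t a)
  have hev : ∀ (X : C) {α : Type (max u v)} (φ : L.Formula α) (t : α → SatName L N₀ I),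
      (∀ i, t i ∈ X.1.dom) → (φ.Realize (V ∘ t) ↔ φ.Realize (v X ∘ t)) := by
    intro X α φ t ht
    rw [hV]
    have h1 : ∀ᶠ Y in (U : Filter C), (φ.Realize (v Y ∘ t) ↔ φ.Realize (v X ∘ t)) := by
      refine Ultrafilter.of_le atTop ((eventually_ge_atTop X).mono fun Y hY => ?_)
      have := hY.mem_truth_iff φ ht
      rw [hv, hv, Formula.realize_relabel, Formula.realize_relabel] at this
      exact this.symm
    rw [eventually_congr h1]
    simp
  have hsub : ∀ X ∈ C, X.dom ⊆ {γ | ∃ X ∈ C, γ ∈ X.dom} := fun X hX γ hγ => ⟨X, hX, hγ⟩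
  refine ⟨{ dom := {γ | ∃ X ∈ C, γ ∈ X.dom}
            truth := {φ | φ.Realize V}
            base_mem := fun x => ⟨X₀, hX₀, X₀.base_mem x⟩
            wit_mem := ?_
            spec := ⟨(U : Filter C).Product K, inferInstance, inferInstance, V,
              fun φ => Iff.rfl, fun φ => ?_, ?_⟩ }, fun X hX => ⟨hsub X hX, fun φ => ?_⟩⟩
  · rintro n i p c ⟨X, hX, h⟩
    exact ⟨fun j => ⟨X, hX, (X.wit_mem n i p c h).1 j⟩,
      fun i' => ⟨X, hX, (X.wit_mem n i p c h).2 i'⟩⟩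
  · rw [hev ⟨X₀, hX₀⟩ φ _ fun x => X₀.base_mem x]
    exact hbase _ _
  · rintro n i p c ⟨X, hX, h⟩ hfin φ hφ
    have hc := X.wit_mem n i p c h
    have h1 : FinSat p (v ⟨X, hX⟩ ∘ c) := hfin.of_realize_iff fun ψ => hev ⟨X, hX⟩ ψ c hc.1
    have h2 := hwit ⟨X, hX⟩ n i p c h h1 φ hφ
    have h3 := hev ⟨X, hX⟩ (φ.relabel (Sum.map id ULift.up : _ → I ⊕ ULift.{max u v} (Fin n)))
      (Sum.elim c fun i' => wit n i'.down p c) (by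
        rintro (j | j)
        · exact hc.1 j
        · exact hc.2 j.down)
    have e : ∀ {K : Type (max u v)} (w : SatName L N₀ I → K),
        (w ∘ (Sum.elim c fun i' : ULift.{max u v} (Fin n) => wit n i'.down p c)) ∘
          Sum.map id ULift.up = Sum.elim (w ∘ c) fun i' => w (wit n i' p c) := by
      intro K w
      funext j
      rcases j with j | j <;> rfl
    rw [Formula.realize_relabel, Formula.realize_relabel, e, e] at h3
    exact h3.2 h2
  · have := hev ⟨X, hX⟩ φ Subtype.val fun i => i.2
    have h4 := hv ⟨X, hX⟩ (φ.relabel Subtype.val)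
    rw [Formula.realize_relabel] at h4
    rw [h4, ← this]
    exact Formula.realize_relabel.symm

/-- A stage at which all parameters of a tuple of names are interpreted can be extended to interpret
that tuple. -/
theorem Stage.exists_extension (X : Stage L N₀ I) {n : ℕ} {i : Fin n}
    {p : Set (L.Formula (I ⊕ Fin n))} {c : I → SatName L N₀ I} (hc : ∀ j, c j ∈ X.dom)
    (hX : wit n i p c ∉ X.dom) : ∃ Y : Stage L N₀ I, X.LE Y ∧ wit n i p c ∈ Y.dom := by
  classical
  have hX' : ∀ i', wit n i' p c ∉ X.dom := fun i' h => hX ((X.wit_mem n i' p c h).2 i)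
  obtain ⟨K, _, _, v, hv, hbase, hwit⟩ := X.spec
  obtain ⟨K', _, _, j, b, hj, hb⟩ : ∃ (K' : Type (max u v)) (_ : L.Structure K')
      (_ : Nonempty K') (j : K → K') (b : Fin n → K'),
      (∀ (φ : L.Formula K), φ.Realize id ↔ φ.Realize j) ∧
      (FinSat p (v ∘ c) → ∀ φ ∈ p, φ.Realize (Sum.elim (j ∘ v ∘ c) b)) := by
    by_cases h : FinSat p (v ∘ c)
    · obtain ⟨K', s, ne, j, b, hj, hb⟩ := h.exists_extension
      exact ⟨K', s, ne, j, b, hj, fun _ => hb⟩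
    · exact ⟨K, inferInstance, inferInstance, id, fun _ => Classical.arbitrary K,
        fun φ => Iff.rfl, fun h' => absurd h' h⟩
  have hj' : ∀ {α : Type (max u v)} (φ : L.Formula α) (t : α → K),
      φ.Realize (j ∘ t) ↔ φ.Realize t := by
    intro α φ t
    have := hj (φ.relabel t)
    rw [Formula.realize_relabel, Formula.realize_relabel] at this
    exact this.symm
  let V : SatName L N₀ I → K' := fun γ =>
    if h : ∃ i', γ = wit n i' p c then b h.choose else j (v γ)
  have hVnew : ∀ i', V (wit n i' p c) = b i' := by
    intro i'
    have h : ∃ i'', (wit n i' p c : SatName L N₀ I) = wit n i'' p c := ⟨i', rfl⟩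
    simp only [V, dif_pos h]
    have := h.choose_spec
    injection this with _ h1
    rw [← h1]
  have hVold : ∀ γ ∈ X.dom, V γ = j (v γ) := by
    intro γ hγ
    have h : ¬ ∃ i', γ = wit n i' p c := by
      rintro ⟨i', rfl⟩
      exact hX' i' hγ
    simp only [V, dif_neg h]
  have hVold' : ∀ {α : Type (max u v)} (t : α → SatName L N₀ I), (∀ a, t a ∈ X.dom) →
      V ∘ t = j ∘ v ∘ t := fun t ht => funext fun a => hVold _ (ht a)
  refine ⟨{ dom := X.dom ∪ Set.range fun i' => wit n i' p c
            truth := {φ | φ.Realize V}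
            base_mem := fun x => Or.inl (X.base_mem x)
            wit_mem := ?_
            spec := ⟨K', inferInstance, inferInstance, V, fun φ => Iff.rfl, fun φ => ?_, ?_⟩ },
    ⟨Set.subset_union_left, fun φ => ?_⟩, Or.inr ⟨i, rfl⟩⟩
  · rintro n' i' p' c' (h | ⟨i'', h⟩)
    · exact ⟨fun k => Or.inl ((X.wit_mem _ _ _ _ h).1 k),
        fun k => Or.inl ((X.wit_mem _ _ _ _ h).2 k)⟩
    · cases h
      exact ⟨fun k => Or.inl (hc k), fun k => Or.inr ⟨k, rfl⟩⟩
  · rw [hVold' _ X.base_mem, hj']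
    exact hbase φ
  · rintro n' i' p' c' (h | ⟨i'', h⟩) hfin φ hφ
    · have hc' := X.wit_mem _ _ _ _ h
      rw [hVold' _ hc'.1] at hfin ⊢
      have h2 := hwit _ _ _ _ h (hfin.of_realize_iff fun ψ => hj' ψ _) φ hφ
      have h3 := hj' (φ.relabel (Sum.map id ULift.up : _ → I ⊕ ULift.{max u v} (Fin n')))
        (Sum.elim (v ∘ c') fun i' => v (wit n' i'.down p' c'))
      rw [Formula.realize_relabel, Formula.realize_relabel] at h3
      have e : (Sum.elim (v ∘ c') fun i' : ULift.{max u v} (Fin n') => v (wit n' i'.down p' c')) ∘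
          Sum.map id ULift.up = Sum.elim (v ∘ c') fun i' => v (wit n' i' p' c') := by
        funext k
        rcases k with k | k <;> rfl
      have e' : (j ∘ Sum.elim (v ∘ c') fun i' : ULift.{max u v} (Fin n') =>
          v (wit n' i'.down p' c')) ∘ Sum.map id ULift.up =
            Sum.elim (j ∘ v ∘ c') fun i' => V (wit n' i' p' c') := by
        funext k
        rcases k with k | k
        · rfl
        · exact (hVold _ (hc'.2 k)).symm
      rw [e, e'] at h3
      exact h3.2 h2
    · cases h
      rw [hVold' _ hc] at hfin ⊢
      have h2 := hb (hfin.of_realize_iff fun ψ => hj' ψ _) φ hφ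
      simp only [hVnew]
      exact h2
  · rw [hv, Formula.realize_relabel]
    refine Iff.trans ?_ (Formula.realize_relabel (v := V)).symm
    rw [hVold' _ fun a => a.2, hj']

variable (L N₀ I) in
/-- There is a stage at which every name is interpreted. -/
theorem Stage.exists_total [Nonempty N₀] : ∃ X : Stage L N₀ I, ∀ γ, γ ∈ X.dom := by
  obtain ⟨X, hX⟩ := exists_maximal_of_chains_bounded (r := Stage.LE (L := L) (N₀ := N₀) (I := I))
    (fun C hC => by
      rcases C.eq_empty_or_nonempty with rfl | hne
      · obtain ⟨X⟩ := Stage.nonempty L N₀ I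
        exact ⟨X, by simp⟩
      · exact Stage.exists_upper_bound hC hne)
    fun h h' => h.trans h'
  refine ⟨X, fun γ => ?_⟩
  induction γ with
  | base x => exact X.base_mem x
  | wit n i p c ih =>
    by_contra h
    obtain ⟨Y, hXY, hY⟩ := X.exists_extension ih h
    exact h ((hX Y hXY).1 hY)

variable (L N₀ I) in
/-- Every structure `N₀` has an elementary extension in which every finitely satisfiable set of
formulas with parameters indexed by the infinite type `I` is realized. -/
theorem exists_realizing_extension [Nonempty N₀] [Infinite I] :
    ∃ (N : Type (max u v)) (_ : L.Structure N) (_ : Nonempty N) (_ : N₀ ↪ₑ[L] N),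
      ∀ (n : ℕ) (p : Set (L.Formula (I ⊕ Fin n))) (c : I → N), FinSat p c →
        ∃ b : Fin n → N, ∀ φ ∈ p, φ.Realize (Sum.elim c b) := by
  classical
  obtain ⟨X, hX⟩ := Stage.exists_total L N₀ I
  obtain ⟨K, _, _, v, -, hbase, hwit⟩ := X.spec
  obtain ⟨x₀⟩ := ‹Nonempty N₀›
  -- Every formula over finitely many named parameters that holds somewhere holds at a name.
  have key : ∀ (n : ℕ) (φ : L.Formula (Fin n ⊕ Fin 1)) (x : Fin n → SatName L N₀ I) (a : K),
      φ.Realize (Sum.elim (v ∘ x) fun _ => a) →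
        ∃ γ, φ.Realize (Sum.elim (v ∘ x) fun _ => v γ) := by
    intro n φ x a hφ
    let ι : Fin n → I := fun k => Infinite.natEmbedding I k
    have hι : Function.Injective ι := fun k l h =>
      Fin.ext ((Infinite.natEmbedding I).injective h)
    let c : I → SatName L N₀ I := Function.extend ι x fun _ => base x₀
    have hc : c ∘ ι = x := funext fun k => hι.extend_apply x (fun _ => base x₀) k
    have e : ∀ y : Fin 1 → K, Sum.elim (v ∘ c) y ∘ Sum.map ι id = Sum.elim (v ∘ x) y := by
      intro y
      rw [← hc]
      funext k
      rcases k with k | k <;> rfl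
    refine ⟨wit 1 0 {φ.relabel (Sum.map ι id)} c, ?_⟩
    have := hwit 1 0 {φ.relabel (Sum.map ι id)} c (hX _) (fun F hF => ⟨fun _ => a, by
      intro ψ hψ
      rw [hF hψ, Formula.realize_relabel, e]
      exact hφ⟩) _ rfl
    rw [Formula.realize_relabel, e] at this
    convert this using 3 with k
    rw [Subsingleton.elim k 0]
  let S : L.Substructure K :=
    { carrier := Set.range v
      fun_mem := by
        intro n f x hx
        choose t ht using hx
        obtain ⟨γ, hγ⟩ := key n (Term.equal (Term.func f fun k => Term.var (Sum.inl k))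
          (Term.var (Sum.inr 0))) t (Structure.funMap f x) (by
            rw [Formula.realize_equal]
            simp [Term.realize, Function.comp_def, ht])
        rw [Formula.realize_equal] at hγ
        refine ⟨γ, ?_⟩
        simpa [Term.realize, Function.comp_def, ht] using hγ.symm }
  have hS : S.IsElementary := by
    refine S.isElementary_of_exists fun n φ x a hφ => ?_
    choose t ht using fun k => (x k).2
    let ρ : Empty ⊕ Fin (n + 1) → Fin n ⊕ Fin 1 :=
      Sum.elim Empty.elim (Fin.snoc (α := fun _ => Fin n ⊕ Fin 1) Sum.inl (Sum.inr 0))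
    have hρ : ∀ y : K, (φ.toFormula.relabel ρ).Realize (Sum.elim (v ∘ t) fun _ => y) ↔
        φ.Realize default (Fin.snoc (Subtype.val ∘ x) y : _ → K) := by
      intro y
      rw [Formula.realize_relabel, BoundedFormula.realize_toFormula, iff_iff_eq]
      congr 1
      · exact Subsingleton.elim _ _
      · funext k
        refine Fin.lastCases ?_ (fun k => ?_) k
        · simp [ρ]
        · simp [ρ, ht]
    obtain ⟨γ, hγ⟩ := key n _ t a ((hρ a).2 hφ)
    exact ⟨⟨v γ, γ, rfl⟩, (hρ _).1 hγ⟩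
  let E : L.ElementarySubstructure K := ⟨S, hS⟩
  have hE : ∀ {α : Type (max u v)} (φ : L.Formula α) (t : α → E),
      φ.Realize (fun a => (t a : K)) ↔ φ.Realize t := fun φ t => E.subtype.map_formula φ t
  have hE' : ∀ {n : ℕ} (φ : L.Formula (I ⊕ Fin n)) (t : I ⊕ Fin n → E),
      φ.Realize (fun a => (t a : K)) ↔ φ.Realize t := fun φ t => E.subtype.map_formula φ t
  refine ⟨E, inferInstance, ⟨⟨v (base x₀), _, rfl⟩⟩,
    { toFun := fun x => ⟨v (base x), _, rfl⟩
      map_formula' := fun n φ x => ?_ }, fun n p c hfin => ?_⟩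
  · have h1 := hbase (φ.relabel x)
    rw [Formula.realize_relabel, Formula.realize_relabel] at h1
    exact (E.subtype.map_formula φ _).symm.trans h1
  · choose t ht using fun k => (c k).2
    have hc : v ∘ t = fun k => (c k : K) := funext ht
    have hfin' : FinSat p (v ∘ t) := by
      rw [hc]
      exact hfin.of_realize_iff fun ψ => (hE ψ c).symm
    have e : ∀ b : Fin n → E, (fun a => ((Sum.elim c b a : E) : K)) =
        Sum.elim (v ∘ t) fun i => (b i : K) := by
      intro b
      rw [hc]
      funext k
      rcases k with k | k <;> rfl
    refine ⟨fun i => ⟨v (wit n i p t), _, rfl⟩, fun φ hφ => ?_⟩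
    rw [← hE', e]
    rcases n with _ | n
    · obtain ⟨b, hb⟩ := hfin' {φ} (by simpa using hφ)
      convert hb φ (by simp) using 2
    · exact hwit _ 0 p t (hX _) hfin' φ hφ

/-- Every structure has a `κ⁺`-saturated elementary extension, for every infinite `κ` (in the
universe at hand, `κ` being the cardinality of `I`). -/
theorem exists_saturated_extension [Nonempty N₀] (κ : Cardinal.{max u v}) (hκ : ℵ₀ ≤ κ) :
    ∃ (N : Type (max u v)) (_ : L.Structure N) (_ : Nonempty N) (_ : N₀ ↪ₑ[L] N),
      IsSaturated L N (Order.succ κ) := by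
  classical
  have : Infinite κ.out := by rw [infinite_iff, mk_out]; exact hκ
  obtain ⟨N, s, ne, j, hN⟩ := exists_realizing_extension L N₀ κ.out
  refine ⟨N, s, ne, j, fun A hA n p => ?_⟩
  have hA' : #A ≤ #κ.out := by rw [mk_out]; exact Order.lt_succ_iff.1 hA
  obtain ⟨g⟩ := hA'
  let c : κ.out → N := Function.extend g Subtype.val fun _ => Classical.arbitrary N
  have hc : c ∘ g = Subtype.val := funext fun k =>
    g.injective.extend_apply Subtype.val (fun _ => Classical.arbitrary N) k
  have e : ∀ y : Fin n → N, Sum.elim c y ∘ Sum.map g id = Sum.elim Subtype.val y := by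
    intro y
    rw [← hc]
    funext k
    rcases k with k | k <;> rfl
  have key : ∀ (φ : L[[A]].Formula (Fin n)) (x : Fin n → N),
      Formula.Realize (BoundedFormula.constantsVarsEquiv φ : L.Formula (A ⊕ Fin n))
        (Sum.elim (↑) x) ↔ φ.Realize x := by
    intro φ x
    unfold Formula.Realize
    rw [← BoundedFormula.realize_constantsVarsEquiv]
    rfl
  let f : L[[A]].Formula (Fin n) → L.Formula (κ.out ⊕ Fin n) := fun φ =>
    Formula.relabel (Sum.map g id) (BoundedFormula.constantsVarsEquiv φ : L.Formula (A ⊕ Fin n))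
  have hf : ∀ (φ : L[[A]].Formula (Fin n)) (x : Fin n → N),
      (f φ).Realize (Sum.elim c x) ↔ φ.Realize x := by
    intro φ x
    rw [Formula.realize_relabel, e, key]
  obtain ⟨U, hU⟩ := exists_ultrafilter_of_completeType (L' := L[[A]]) (N := N) p
  obtain ⟨b, hb⟩ := hN n (f '' {φ | Formula.equivSentence φ ∈ p}) c (fun F hF => by
    have h1 : ∀ᶠ x in (U : Filter (Fin n → N)), ∀ ψ ∈ F, ψ.Realize (Sum.elim c x) := by
      rw [Filter.eventually_all_finset]
      intro ψ hψ
      obtain ⟨φ, hφ, rfl⟩ := hF hψ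
      simp only [hf]
      exact (hU φ).1 hφ
    exact h1.exists)
  have hb' : ∀ φ : L[[A]].Formula (Fin n), Formula.equivSentence φ ∈ p → φ.Realize b :=
    fun φ hφ => (hf φ b).1 (hb _ ⟨φ, hφ, rfl⟩)
  refine ⟨b, SetLike.ext fun ψ => ?_⟩
  obtain ⟨φ, rfl⟩ := Formula.equivSentence.surjective ψ
  unfold typeOver
  rw [Theory.CompleteType.formula_mem_typeOf]
  refine ⟨fun h => ?_, hb' φ⟩
  by_contra hn
  have h2 : Formula.equivSentence φ.not ∈ p := by
    rw [hU] at hn ⊢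
    simpa only [Formula.realize_not, Ultrafilter.eventually_not] using hn
  exact (Formula.realize_not.1 (hb' _ h2)) h

end Saturation

/-! ### Invariant Morley sequences -/

section Sequences

universe w

variable {N : Type w}

/-- The set of all entries of the tuples `s j` with `j < i`. -/
def entriesBelow {n : ℕ} (s : ℕ → Fin n → N) (i : ℕ) : Set N :=
  {y | ∃ j < i, ∃ t, y = s j t}

theorem countable_entriesBelow {n : ℕ} (s : ℕ → Fin n → N) (i : ℕ) :
    (entriesBelow s i).Countable := by
  have : entriesBelow s i ⊆ Set.range fun p : ℕ × Fin n => s p.1 p.2 := by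
    rintro y ⟨j, -, t, rfl⟩
    exact ⟨(j, t), rfl⟩
  exact (Set.countable_range _).mono this

theorem mk_union_lt_of_countable {κ : Cardinal.{w}} (hκ : ℵ₀ < κ) {A B : Set N}
    (hA : #A < κ) (hB : B.Countable) : #(A ∪ B : Set N) < κ :=
  (mk_union_le A B).trans_lt
    (add_lt_of_lt hκ.le hA ((le_aleph0_iff_set_countable.2 hB).trans_lt hκ))

/-- The sequence starting with `d` each of whose later terms is chosen by `f` from the set of all
entries of the earlier ones. -/
def recSeq {n : ℕ} (d : Fin n → N) (f : Set N → Fin n → N) : ℕ → Fin n → N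
  | 0 => d
  | i + 1 => f {y | ∃ (j : Fin (i + 1)) (t : Fin n), y = recSeq d f j.1 t}

theorem recSeq_succ {n : ℕ} (d : Fin n → N) (f : Set N → Fin n → N) (i : ℕ) :
    recSeq d f (i + 1) = f (entriesBelow (recSeq d f) (i + 1)) := by
  rw [recSeq]
  congr 1
  ext y
  constructor
  · rintro ⟨j, t, h⟩
    exact ⟨j.1, j.2, t, h⟩
  · rintro ⟨j, hj, t, h⟩
    exact ⟨⟨j, hj⟩, t, h⟩

end Sequences

section Morley

variable {L : FirstOrder.Language.{u, v}} {N : Type (max u v)} [L.Structure N] [Nonempty N]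

/-- The limit of the ultrafilter `U` is invariant over `M`. -/
def InvariantLimit {n : ℕ} (M : L.ElementarySubstructure N) (U : Ultrafilter (Fin n → N)) : Prop :=
  ∀ (k : ℕ) (φ : L.Formula (Fin n ⊕ Fin k)) (c d : Fin k → N),
    typeOver (L := L) (M : Set N) c = typeOver (M : Set N) d →
      (∀ᶠ x in (U : Filter (Fin n → N)), φ.Realize (Sum.elim x c)) →
        ∀ᶠ x in (U : Filter (Fin n → N)), φ.Realize (Sum.elim x d)

/-- Finitely satisfiable types are invariant. -/
theorem invariantLimit_of_eventually_mem {n : ℕ} {M : L.ElementarySubstructure N}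
    {U : Ultrafilter (Fin n → N)} (hU : ∀ᶠ x in (U : Filter (Fin n → N)), ∀ i, x i ∈ M) :
    InvariantLimit M U := by
  intro k φ c d hcd h
  filter_upwards [hU, h] with x hx hc
  have h1 := realize_iff_of_typeOver_eq hcd (φ.relabel Sum.swap) (c := x) hx
  have e : ∀ y : Fin k → N, Sum.elim y x ∘ Sum.swap = Sum.elim x y := by
    intro y
    funext t
    rcases t with t | t <;> rfl
  rw [Formula.realize_relabel, Formula.realize_relabel, e, e] at h1
  exact h1.1 hc

omit [Nonempty N] in
/-- The type of any tuple over `M` is the restriction of a type finitely satisfiable in `M`. -/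
theorem exists_finitelySatisfiable_extension (M : L.ElementarySubstructure N) {n : ℕ}
    (d : Fin n → N) : ∃ U : Ultrafilter (Fin n → N),
      (∀ᶠ x in (U : Filter (Fin n → N)), ∀ i, x i ∈ M) ∧ RealizesLimit L U (M : Set N) d := by
  obtain ⟨U, hU⟩ := exists_ultrafilter_of_finite_inter
    (fun φ : {φ : L.Formula ((M : Set N) ⊕ Fin n) // φ.Realize (Sum.elim (↑) d)} =>
      {x : Fin n → N | (∀ i, x i ∈ M) ∧ φ.1.Realize (Sum.elim (↑) x)}) (by
    intro F
    have h1 : (Formula.iExs (Fin n) (Formula.iInf fun φ : F => φ.1.1)).Realize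
        (fun x : (M : Set N) => (x : N)) := by
      rw [Formula.realize_iExs]
      exact ⟨d, by rw [Formula.realize_iInf]; exact fun φ => φ.1.2⟩
    have h2 := (M.subtype.map_formula
      (Formula.iExs (Fin n) (Formula.iInf fun φ : F => φ.1.1)) (id : M → M)).1 h1
    rw [Formula.realize_iExs] at h2
    obtain ⟨x, hx⟩ := h2
    refine ⟨fun i => x i, fun φ hφ => ⟨fun i => (x i).2, ?_⟩⟩
    have h3 := (M.subtype.map_formula (Formula.iInf fun φ : F => φ.1.1)
      (Sum.elim (id : M → M) x)).2 hx
    rw [Formula.realize_iInf] at h3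
    convert h3 ⟨φ, hφ⟩ using 1
    funext i
    rcases i with i | i <;> rfl)
  refine ⟨U, ?_, fun φ => ⟨fun h => ?_, fun h => ?_⟩⟩
  · filter_upwards [hU ⟨⊤, Formula.realize_top.2 trivial⟩] with x hx using hx.1
  · filter_upwards [hU ⟨φ, h⟩] with x hx using hx.2
  · by_contra hn
    have h1 := hU ⟨φ.not, hn⟩
    obtain ⟨x, h2, h3⟩ := (h.and h1).exists
    exact (Formula.realize_not.1 h3.2) h2

/-- In a saturated structure, a realization over `M` of the limit of `U` starts a sequence whose
later terms realize the limit of `U` over `M` and the earlier terms. -/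
theorem IsSaturated.exists_sequence {κ : Cardinal.{max u v}} (hN : IsSaturated L N κ)
    (hκ : ℵ₀ < κ) {M : Set N} (hM : #M < κ) {n : ℕ}
    (U : Ultrafilter (Fin n → N)) (d : Fin n → N) :
    ∃ s : ℕ → Fin n → N, s 0 = d ∧
      ∀ i, RealizesLimit L U (M ∪ entriesBelow s (i + 1)) (s (i + 1)) := by
  classical
  have h1 : ∀ B : Set N, ∃ a, B.Countable → RealizesLimit L U (M ∪ B) a := by
    intro B
    by_cases hB : B.Countable
    · obtain ⟨a, ha⟩ := hN.exists_realizesLimit U (mk_union_lt_of_countable hκ hM hB)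
      exact ⟨a, fun _ => ha⟩
    · exact ⟨d, fun h => absurd h hB⟩
  choose f hf using h1
  refine ⟨recSeq d f, by rw [recSeq], fun i => ?_⟩
  rw [recSeq_succ]
  exact hf _ (countable_entriesBelow _ _)

theorem isInvariantMorleySequence_of_realizesLimit {M : L.ElementarySubstructure N} {n : ℕ}
    {U : Ultrafilter (Fin n → N)} (hU : InvariantLimit M U) {s : ℕ → Fin n → N}
    (h0 : ∀ (k : ℕ) (φ : L.Formula (Fin n ⊕ Fin k)) (c : Fin k → N), (∀ j, c j ∈ M) →
      (∀ᶠ x in (U : Filter (Fin n → N)), φ.Realize (Sum.elim x c)) →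
        φ.Realize (Sum.elim (s 0) c))
    (hs : ∀ i, RealizesLimit L U ((M : Set N) ∪ entriesBelow s (i + 1)) (s (i + 1))) :
    IsInvariantMorleySequence (L := L) M s := by
  refine ⟨globalLimit U, fun k φ c d hcd => ?_, fun i k φ c hc h => ?_⟩
  · rw [globalLimit_hasFormula, globalLimit_hasFormula]
    exact ⟨hU k φ c d hcd, hU k φ d c hcd.symm⟩
  · rw [globalLimit_hasFormula] at h
    rcases i with _ | i
    · refine h0 k φ c (fun j => ?_) h
      rcases hc j with h1 | ⟨j', hj', -⟩
      · exact h1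
      · exact absurd hj' (Nat.not_lt_zero _)
    · exact ((hs i).realize_iff φ hc).2 h

/-- Every tuple starts an invariant Morley sequence, all terms of which have the same type
over `M`. -/
theorem IsSaturated.exists_isInvariantMorleySequence {κ : Cardinal.{max u v}}
    (hN : IsSaturated L N κ) (hκ : ℵ₀ < κ) {M : L.ElementarySubstructure N} (hM : #M < κ) {n : ℕ}
    (d : Fin n → N) : ∃ s : ℕ → Fin n → N, s 0 = d ∧ IsInvariantMorleySequence (L := L) M s := by
  obtain ⟨U, hU, hd⟩ := exists_finitelySatisfiable_extension M d
  obtain ⟨s, h0, hs⟩ := hN.exists_sequence hκ hM U d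
  refine ⟨s, h0, isInvariantMorleySequence_of_realizesLimit
    (invariantLimit_of_eventually_mem hU) (fun k φ c hc h => ?_) hs⟩
  rw [h0]
  exact (hd.realize_iff φ hc).2 h

/-- Formulas over `M` and the earlier terms true of a term of a Morley sequence belong to the global
type of the sequence. -/
theorem GlobalType.RealizesOver.hasFormula_iff {n : ℕ} {p : GlobalType L N n} {A : Set N}
    {a : Fin n → N} (h : p.RealizesOver A a) {k : ℕ} (φ : L.Formula (Fin n ⊕ Fin k))
    {c : Fin k → N} (hc : ∀ j, c j ∈ A) : p.HasFormula φ c ↔ φ.Realize (Sum.elim a c) := by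
  obtain ⟨U, hU⟩ := p.exists_ultrafilter
  refine ⟨h k φ c hc, fun h1 => ?_⟩
  by_contra hn
  have h2 : p.HasFormula φ.not c := by
    rw [hU] at hn ⊢
    simpa only [Formula.realize_not, Ultrafilter.eventually_not] using hn
  exact (Formula.realize_not.1 (h k _ c hc h2)) h1

/-- All terms of an invariant Morley sequence satisfy the same formulas over `M`. -/
theorem IsInvariantMorleySequence.realize_iff {M : L.ElementarySubstructure N} {n : ℕ}
    {s : ℕ → Fin n → N} (hs : IsInvariantMorleySequence (L := L) M s) {k : ℕ}
    (φ : L.Formula (Fin n ⊕ Fin k)) {c : Fin k → N} (hc : ∀ j, c j ∈ M) (i i' : ℕ) :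
    φ.Realize (Sum.elim (s i) c) ↔ φ.Realize (Sum.elim (s i') c) := by
  obtain ⟨p, -, hp⟩ := hs
  rw [← (hp i).hasFormula_iff φ fun j => Or.inl (hc j),
    (hp i').hasFormula_iff φ fun j => Or.inl (hc j)]

/-- Entries of an invariant Morley sequence which lie in `M` are constant. -/
theorem IsInvariantMorleySequence.eq_of_mem {M : L.ElementarySubstructure N} {n : ℕ}
    {s : ℕ → Fin n → N} (hs : IsInvariantMorleySequence (L := L) M s) {i i' : ℕ} {t : Fin n}
    (ht : s i t ∈ M) : s i' t = s i t := by
  have := hs.realize_iff (Term.equal (Term.var (Sum.inl t)) (Term.var (Sum.inr 0)))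
    (c := fun _ : Fin 1 => s i t) (fun _ => ht) i' i
  simpa [Formula.realize_equal] using this

/-- Subtuples of the terms of an invariant Morley sequence form an invariant Morley sequence. -/
theorem IsInvariantMorleySequence.comp {M : L.ElementarySubstructure N} {n m : ℕ}
    {s : ℕ → Fin n → N} (hs : IsInvariantMorleySequence (L := L) M s) (ρ : Fin m → Fin n) :
    IsInvariantMorleySequence (L := L) M fun i => s i ∘ ρ := by
  obtain ⟨p, hinv, hp⟩ := hs
  obtain ⟨U, hU⟩ := p.exists_ultrafilter
  have e : ∀ {k : ℕ} (x : Fin n → N) (c : Fin k → N),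
      Sum.elim x c ∘ Sum.map ρ id = Sum.elim (x ∘ ρ) c := by
    intro k x c
    funext t
    rcases t with t | t <;> rfl
  have key : ∀ (k : ℕ) (φ : L.Formula (Fin m ⊕ Fin k)) (c : Fin k → N),
      (globalLimit (U.map (· ∘ ρ)) : GlobalType L N m).HasFormula φ c ↔
        p.HasFormula (φ.relabel (Sum.map ρ id)) c := by
    intro k φ c
    rw [globalLimit_hasFormula, hU, Ultrafilter.coe_map, Filter.eventually_map]
    simp only [Formula.realize_relabel, e]
  refine ⟨globalLimit (U.map (· ∘ ρ)), fun k φ c d hcd => ?_, fun i k φ c hc h => ?_⟩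
  · rw [key, key]
    exact hinv k _ c d hcd
  · rw [key] at h
    have := hp i k _ c (fun j => ?_) h
    · rwa [Formula.realize_relabel, e] at this
    · rcases hc j with h1 | ⟨j', hj', t, ht⟩
      · exact Or.inl h1
      · exact Or.inr ⟨j', hj', ρ t, ht⟩

end Morley

/-! ### Calculus of Conant-independence -/

section Independence

variable {L : FirstOrder.Language.{u, v}} {N : Type (max u v)} [L.Structure N] [Nonempty N]
  {M : L.ElementarySubstructure N}

/-- The formula `ψ(σ(x, m), d)`, with parameters `(m, d)`, obtained from `ψ(x, d)` by replacing each
variable of `x` by a new variable or by an entry of `m`, as prescribed by `σ`. -/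
def substParams {n n' k l : ℕ} (σ : Fin n → Fin n' ⊕ Fin k) (ψ : L.Formula (Fin n ⊕ Fin l)) :
    L.Formula (Fin n' ⊕ Fin (k + l)) :=
  ψ.relabel (Sum.elim (fun x => Sum.map id (Fin.castAdd l) (σ x))
    fun j => Sum.inr (Fin.natAdd k j))

omit [Nonempty N] in
theorem realize_substParams {n n' k l : ℕ} (σ : Fin n → Fin n' ⊕ Fin k)
    (ψ : L.Formula (Fin n ⊕ Fin l)) (a : Fin n' → N) (c : Fin (k + l) → N) :
    (substParams σ ψ).Realize (Sum.elim a c) ↔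
      ψ.Realize (Sum.elim (Sum.elim a (c ∘ Fin.castAdd l) ∘ σ) (c ∘ Fin.natAdd k)) := by
  unfold substParams
  rw [Formula.realize_relabel]
  have e : Sum.elim a c ∘ (Sum.elim (fun x => Sum.map id (Fin.castAdd l) (σ x))
      fun j => Sum.inr (Fin.natAdd k j)) =
      Sum.elim (Sum.elim a (c ∘ Fin.castAdd l) ∘ σ) (c ∘ Fin.natAdd k) := by
    funext t
    rcases t with t | t
    · simp only [Function.comp_apply, Sum.elim_inl]
      rcases σ t with y | y <;> rfl
    · rfl
  rw [e]

theorem ConantDivides.substParams {n n' k l : ℕ} {ψ : L.Formula (Fin n ⊕ Fin l)} {d : Fin l → N}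
    (h : ConantDivides M ψ d) (σ : Fin n → Fin n' ⊕ Fin k) {m : Fin k → N} (hm : ∀ t, m t ∈ M) :
    ConantDivides M (substParams σ ψ) (Fin.append m d) := by
  intro s hs h0
  obtain ⟨F, hF⟩ := h _ (hs.comp (Fin.natAdd k)) (by
    rw [h0]
    funext j
    simp)
  refine ⟨F, fun ⟨a, ha⟩ => hF ⟨Sum.elim a m ∘ σ, fun i hi => ?_⟩⟩
  have h1 := (realize_substParams σ ψ a (s i)).1 (ha i hi)
  have h2 : s i ∘ Fin.castAdd l = m := by
    funext t
    have h3 : s 0 (Fin.castAdd l t) = m t := by rw [h0]; simp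
    have := hs.eq_of_mem (i := 0) (i' := i) (t := Fin.castAdd l t) (by rw [h3]; exact hm t)
    rw [Function.comp_apply, this, h3]
  rwa [h2] at h1

theorem ConantForks.substParams {n n' k l : ℕ} {φ : L.Formula (Fin n ⊕ Fin l)} {c : Fin l → N}
    (h : ConantForks M φ c) (σ : Fin n → Fin n' ⊕ Fin k) {m : Fin k → N} (hm : ∀ t, m t ∈ M) :
    ConantForks M (substParams σ φ) (Fin.append m c) := by
  obtain ⟨r, l', ψ, d, hd, himp⟩ := h
  refine ⟨r, fun j => k + l' j, fun j => ConantIndependence.substParams σ (ψ j),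
    fun j => Fin.append m (d j),
    fun j => (hd j).substParams σ hm, fun a ha => ?_⟩
  rw [realize_substParams] at ha
  have e : ∀ {l : ℕ} (c : Fin l → N), Fin.append m c ∘ Fin.castAdd l = m ∧
      Fin.append m c ∘ Fin.natAdd k = c := fun c =>
    ⟨funext fun t => by simp, funext fun t => by simp⟩
  rw [(e c).1, (e c).2] at ha
  obtain ⟨j, hj⟩ := himp _ ha
  refine ⟨j, ?_⟩
  rw [realize_substParams, (e (d j)).1, (e (d j)).2]
  exact hj

/-- Elements of `M` may be added on the left: in a formula true of a tuple from `M ∪ A` the entries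
from `M` can be regarded as parameters. -/
theorem ConantIndep.union_model {A B : Set N} (h : ConantIndep M A B) :
    ConantIndep M ((M : Set N) ∪ A) B := by
  classical
  intro n k φ a c ha hc hφ hforks
  let e := Fintype.equivFin {t : Fin n // a t ∈ A}
  obtain ⟨m₀⟩ : Nonempty M := inferInstance
  let m : Fin n → N := fun t => if a t ∈ A then m₀ else a t
  have hm : ∀ t, m t ∈ M := by
    intro t
    by_cases h1 : a t ∈ A
    · simp only [m, if_pos h1]; exact m₀.2
    · simp only [m, if_neg h1]; exact (ha t).resolve_right h1
  let σ : Fin n → Fin (Fintype.card {t : Fin n // a t ∈ A}) ⊕ Fin n := fun t =>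
    if h1 : a t ∈ A then Sum.inl (e ⟨t, h1⟩) else Sum.inr t
  refine h _ _ (substParams σ φ) (fun t => a (e.symm t).1) (Fin.append m c)
    (fun t => (e.symm t).2) (fun j => ?_) ?_ (hforks.substParams σ hm)
  · refine Fin.addCases (fun t => ?_) (fun t => ?_) j
    · rw [Fin.append_left]; exact Or.inl (hm t)
    · rw [Fin.append_right]; exact hc t
  · rw [realize_substParams]
    convert hφ using 2
    · funext t
      by_cases h1 : a t ∈ A
      · simp [σ, h1]
      · simp [σ, h1, m]
    · funext t; simp

/-- The empty set is independent from every set, because every tuple starts an invariant Morley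
sequence. -/
theorem conantIndep_empty {κ : Cardinal.{max u v}} (hN : IsSaturated L N κ) (hκ : ℵ₀ < κ)
    (hM : #M < κ) (B : Set N) : ConantIndep M ∅ B := by
  rintro n k φ a c ha - hφ ⟨r, l, ψ, d, hd, himp⟩
  obtain ⟨j, hj⟩ := himp a hφ
  obtain ⟨s, h0, hs⟩ := hN.exists_isInvariantMorleySequence hκ hM (d j)
  obtain ⟨F, hF⟩ := hd j s hs h0
  refine hF ⟨a, fun i _ => ?_⟩
  obtain rfl : n = 0 := by
    by_contra hn
    exact ha ⟨0, Nat.pos_of_ne_zero hn⟩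
  have e : ∀ x : Fin (l j) → N,
      Sum.elim x (Fin.elim0 : Fin 0 → N) ∘ (Sum.elim (fun t => Fin.elim0 t) Sum.inl :
        Fin 0 ⊕ Fin (l j) → Fin (l j) ⊕ Fin 0) = Sum.elim a x := by
    intro x
    funext t
    rcases t with t | t
    · exact Fin.elim0 t
    · rfl
  have h1 := hs.realize_iff ((ψ j).relabel (Sum.elim (fun t => Fin.elim0 t) Sum.inl :
        Fin 0 ⊕ Fin (l j) → Fin (l j) ⊕ Fin 0)) (c := Fin.elim0) (fun t => Fin.elim0 t) 0 i
  rw [Formula.realize_relabel, Formula.realize_relabel, e, e, h0] at h1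
  exact h1.1 hj

/-- If `A` is independent from `B` and the type of `d` over `M ∪ A ∪ B` is finitely satisfiable in
`M`, then `A ∪ d` is independent from `B`: in a formula true of a tuple from `A ∪ d` the entries of
`d` can be replaced by elements of `M`. -/
theorem ConantIndep.union_range {A B : Set N} (h : ConantIndep M A B) {r : ℕ}
    {U : Ultrafilter (Fin r → N)} (hU : ∀ᶠ x in (U : Filter (Fin r → N)), ∀ i, x i ∈ M)
    {d : Fin r → N} (hd : RealizesLimit L U ((M : Set N) ∪ (A ∪ B)) d) :
    ConantIndep M (A ∪ Set.range d) B := by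
  classical
  intro n k φ a c ha hc hφ hforks
  obtain ⟨x₀⟩ : Nonempty M := inferInstance
  let m : Fin n → N := fun t => if a t ∈ A then a t else x₀
  have hm : ∀ t, m t ∈ (M : Set N) ∪ A := by
    intro t
    by_cases h1 : a t ∈ A
    · simp only [m, if_pos h1]; exact Or.inr h1
    · simp only [m, if_neg h1]; exact Or.inl x₀.2
  let σ : Fin n → Fin r ⊕ Fin n := fun t =>
    if h1 : a t ∈ A then Sum.inr t else Sum.inl ((ha t).resolve_left h1).choose
  have hσ : Sum.elim d m ∘ σ = a := by
    funext t
    by_cases h1 : a t ∈ A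
    · simp [σ, h1, m]
    · simp only [σ, h1, dite_false, Function.comp_apply, Sum.elim_inl]
      exact ((ha t).resolve_left h1).choose_spec
  have e : ∀ x : Fin r → N, (substParams σ φ).Realize (Sum.elim x (Fin.append m c)) ↔
      φ.Realize (Sum.elim (Sum.elim x m ∘ σ) c) := by
    intro x
    rw [realize_substParams]
    have h1 : Fin.append m c ∘ Fin.castAdd k = m := funext fun t => by simp
    have h2 : Fin.append m c ∘ Fin.natAdd n = c := funext fun t => by simp
    rw [h1, h2]
  have h1 := (hd.realize_iff (substParams σ φ) (c := Fin.append m c) (fun j => by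
    refine Fin.addCases (fun t => ?_) (fun t => ?_) j
    · rw [Fin.append_left]
      exact (hm t).imp_right Or.inl
    · rw [Fin.append_right]
      exact (hc t).imp_right Or.inr)).1 ((e d).2 (by rw [hσ]; exact hφ))
  obtain ⟨x, hx, hφx⟩ := (hU.and h1).exists
  refine h.union_model n k φ _ c (fun t => ?_) hc ((e x).1 hφx) hforks
  rcases hy : σ t with y | y
  · simp only [Function.comp_apply, hy, Sum.elim_inl]
    exact Or.inl (hx y)
  · simp only [Function.comp_apply, hy, Sum.elim_inr]
    exact hm y

end Independence

/-! ### Symmetry implies the absence of the strong order property `SOP₄` -/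

section Symmetric

variable {L : FirstOrder.Language.{u, v}}

/-- `R(x, y)` between the `i`-th block of the first tuple and the `j`-th block of the second one. -/
def blockRel {k r t : ℕ} (R : L.Formula (Fin k ⊕ Fin k)) (i : Fin r) (j : Fin t) :
    L.Formula (Fin (r * k) ⊕ Fin (t * k)) :=
  R.relabel (Sum.map (fun u => finProdFinEquiv (i, u)) fun u => finProdFinEquiv (j, u))

/-- The concatenation of a tuple of tuples. -/
def concat {N : Type*} {k r : ℕ} (a : Fin r → Fin k → N) : Fin (r * k) → N := fun t =>
  a (finProdFinEquiv.symm t).1 (finProdFinEquiv.symm t).2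

/-- The `i`-th block of a concatenation. -/
def block {N : Type*} {k r : ℕ} (a : Fin (r * k) → N) (i : Fin r) : Fin k → N := fun u =>
  a (finProdFinEquiv (i, u))

@[simp] theorem block_concat {N : Type*} {k r : ℕ} (a : Fin r → Fin k → N) (i : Fin r) :
    block (concat a) i = a i := by
  funext u
  simp [block, concat]

theorem realize_blockRel {N : Type*} [L.Structure N] {k r t : ℕ} (R : L.Formula (Fin k ⊕ Fin k))
    (i : Fin r) (j : Fin t) (a : Fin (r * k) → N) (b : Fin (t * k) → N) :
    (blockRel R i j).Realize (Sum.elim a b) ↔ R.Realize (Sum.elim (block a i) (block b j)) := by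
  unfold blockRel
  rw [Formula.realize_relabel, Sum.elim_comp_map]
  rfl

/-- The reverse relation `R(y, x)`. -/
def reverseRel {α β : Type*} (R : L.Formula (α ⊕ β)) : L.Formula (β ⊕ α) := R.relabel Sum.swap

theorem realize_reverseRel {N : Type*} [L.Structure N] {α β : Type*} (R : L.Formula (α ⊕ β))
    (a : β → N) (b : α → N) :
    (reverseRel R).Realize (Sum.elim a b) ↔ R.Realize (Sum.elim b a) := by
  unfold reverseRel
  rw [Formula.realize_relabel]
  have e : Sum.elim a b ∘ Sum.swap = Sum.elim b a := by
    funext t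
    rcases t with t | t <;> rfl
  rw [e]

/-- The formula `∃ z, R(x, z) ∧ R(z, y)`. -/
noncomputable def compRel {k : ℕ} (R : L.Formula (Fin k ⊕ Fin k)) : L.Formula (Fin k ⊕ Fin k) :=
  Formula.iExs (Fin k) (R.relabel (Sum.elim (fun u => Sum.inl (Sum.inl u)) Sum.inr) ⊓
    R.relabel (Sum.elim Sum.inr fun u => Sum.inl (Sum.inr u)))

theorem realize_compRel {N : Type*} [L.Structure N] {k : ℕ} (R : L.Formula (Fin k ⊕ Fin k))
    (a b : Fin k → N) : (compRel R).Realize (Sum.elim a b) ↔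
      ∃ z : Fin k → N, R.Realize (Sum.elim a z) ∧ R.Realize (Sum.elim z b) := by
  unfold compRel
  rw [Formula.realize_iExs]
  refine exists_congr fun z => ?_
  rw [Formula.realize_inf, Formula.realize_relabel, Formula.realize_relabel]
  have e1 : Sum.elim (Sum.elim a b) z ∘ Sum.elim (fun u => Sum.inl (Sum.inl u)) Sum.inr =
      Sum.elim a z := by
    funext t
    rcases t with t | t <;> rfl
  have e2 : Sum.elim (Sum.elim a b) z ∘ Sum.elim Sum.inr (fun u => Sum.inl (Sum.inr u)) =
      Sum.elim z b := by
    funext t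
    rcases t with t | t <;> rfl
  rw [e1, e2]

variable {N : Type (max u v)} [L.Structure N] [Nonempty N]

/-- If `R` is instantiated along a path `y → x → z → x' → w` such that `(x, x')` is independent
from `(y, z, w)` over `M` and `y`, `w` have the same type over `M`, then `R` has a `4`-cycle. -/
theorem exists_four_cycle_of_conantIndep {M : L.ElementarySubstructure N} {k : ℕ}
    (R : L.Formula (Fin k ⊕ Fin k)) {y x z x' w : Fin k → N}
    (hyx : R.Realize (Sum.elim y x)) (hxz : R.Realize (Sum.elim x z))
    (hzx' : R.Realize (Sum.elim z x')) (hx'w : R.Realize (Sum.elim x' w))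
    (hyw : typeOver (L := L) (M : Set N) y = typeOver (M : Set N) w)
    (hind : ConantIndep M (Set.range x ∪ Set.range x') (Set.range y ∪ Set.range z ∪ Set.range w)) :
    ∃ c : Fin (1 + 3) → Fin k → N, ∀ i, R.Realize (Sum.elim (c i) (c (i + 1))) := by
  -- The path as a formula in the variables `(x, x')`, with parameters `(y, z, w)`.
  let φ : L.Formula (Fin (2 * k) ⊕ Fin (3 * k)) :=
    (reverseRel (blockRel R 0 0) ⊓ blockRel R 0 1) ⊓ (reverseRel (blockRel R 1 1) ⊓ blockRel R 1 2)
  have hφ : ∀ (a : Fin (2 * k) → N) (b : Fin (3 * k) → N), φ.Realize (Sum.elim a b) ↔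
      (R.Realize (Sum.elim (block b 0) (block a 0)) ∧ R.Realize (Sum.elim (block a 0) (block b 1))) ∧
      (R.Realize (Sum.elim (block b 1) (block a 1)) ∧
        R.Realize (Sum.elim (block a 1) (block b 2))) := by
    intro a b
    simp only [φ, Formula.realize_inf, realize_reverseRel, realize_blockRel]
  have h1 : ¬ ConantForks M φ (concat ![y, z, w]) := by
    refine hind _ _ φ (concat ![x, x']) _ (fun t => ?_) (fun t => ?_) ?_
    · unfold concat
      generalize (finProdFinEquiv.symm t).1 = i
      fin_cases i
      · exact Or.inl ⟨_, rfl⟩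
      · exact Or.inr ⟨_, rfl⟩
    · unfold concat
      generalize (finProdFinEquiv.symm t).1 = i
      fin_cases i
      · exact Or.inr (Or.inl (Or.inl ⟨_, rfl⟩))
      · exact Or.inr (Or.inl (Or.inr ⟨_, rfl⟩))
      · exact Or.inr (Or.inr ⟨_, rfl⟩)
    · rw [hφ]
      simp only [block_concat]
      exact ⟨⟨hyx, hxz⟩, hzx', hx'w⟩
  have h2 : ¬ ConantDivides M φ (concat ![y, z, w]) := fun h =>
    h1 ⟨1, fun _ => 3 * k, fun _ => φ, fun _ => concat ![y, z, w], fun _ => h, fun a ha => ⟨0, ha⟩⟩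
  unfold ConantDivides at h2
  push Not at h2
  obtain ⟨s, ⟨p, hinv, hp⟩, h0, hF⟩ := h2
  obtain ⟨a, ha⟩ := hF {0, 1}
  have ha0 := (hφ _ _).1 (ha 0 (by simp))
  have ha1 := (hφ _ _).1 (ha 1 (by simp))
  have hy : block (s 0) 0 = y := by rw [h0, block_concat]; rfl
  have hw : block (s 0) 2 = w := by rw [h0, block_concat]; rfl
  rw [hy, hw] at ha0
  -- In the second term `(y₁, z₁, w₁)` of the sequence, `z₁` is two steps before `w`, hence also,
  -- by invariance, two steps before `y`.
  let θ : L.Formula (Fin (3 * k) ⊕ Fin k) :=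
    (compRel R).relabel (Sum.map (fun u => finProdFinEquiv ((1 : Fin 3), u)) id)
  have hθ : ∀ (b : Fin (3 * k) → N) (c : Fin k → N), θ.Realize (Sum.elim b c) ↔
      ∃ z' : Fin k → N, R.Realize (Sum.elim (block b 1) z') ∧ R.Realize (Sum.elim z' c) := by
    intro b c
    rw [← realize_compRel, Formula.realize_relabel, Sum.elim_comp_map]
    rfl
  have hmem : ∀ (c : Fin k → N) (i : Fin 3), block (s 0) i = c →
      ∀ u, c u ∈ (M : Set N) ∪ {y | ∃ j < 1, ∃ t, y = s j t} := by
    rintro c i rfl u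
    exact Or.inr ⟨0, Nat.one_pos, _, rfl⟩
  have h3 : p.HasFormula θ w :=
    ((hp 1).hasFormula_iff θ (hmem w 2 hw)).2 ((hθ _ _).2 ⟨block a 1, ha1.2.1, ha0.2.2⟩)
  have h4 : p.HasFormula θ y := (hinv k θ y w hyw).2 h3
  obtain ⟨x'', h5, h6⟩ := (hθ _ _).1 (((hp 1).hasFormula_iff θ (hmem y 0 hy)).1 h4)
  refine ⟨![y, block a 0, block (s 1) 1, x''], fun i => ?_⟩
  fin_cases i
  · exact ha0.1.1
  · exact ha1.1.2
  · exact h5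
  · exact h6

/-- Along a finitely satisfiable Morley sequence `s` in the limit of a chain for `R`, symmetry makes
`s 1, s 3` independent from `s 0, s 2, s 4`, so that `R` has a `4`-cycle. -/
theorem isNSOP_four_of_symmetric {T : L.Theory} (hT : HasSymmetricConantIndependence T) :
    IsNSOP T 4 := by
  rintro ⟨N₀, k, R, hcycle, a, ha⟩
  obtain ⟨N, _, _, j, hN⟩ := exists_saturated_extension.{u, v} (L := L) (N₀ := N₀)
    (max L.card ℵ₀) (le_max_right _ _)
  have hκ : max L.card ℵ₀ < Order.succ (max L.card ℵ₀) := Order.lt_succ _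
  set κ := Order.succ (max L.card ℵ₀) with hκdef
  have hω : ℵ₀ < κ := (le_max_right _ _).trans_lt hκ
  have hNT : N ⊨ T := (j.theory_model_iff T).1 inferInstance
  -- A small elementary substructure containing the infinite chain.
  obtain ⟨M, haM, hM⟩ : ∃ M : L.ElementarySubstructure N,
      (∀ i u, j (a i u) ∈ M) ∧ #M < κ := by
    rcases le_total (max L.card ℵ₀) #N with h | h
    · obtain ⟨M, h1, h2⟩ := exists_elementarySubstructure_card_eq L
        (Set.range fun q : ℕ × Fin k => j (a q.1 q.2)) (max L.card ℵ₀) (le_max_right _ _)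
        (by
          rw [lift_id, lift_id]
          exact (le_aleph0_iff_set_countable.2 (Set.countable_range _)).trans (le_max_right _ _))
        (by simp) (by simpa using h)
      refine ⟨M, fun i u => h1 ⟨(i, u), rfl⟩, ?_⟩
      rw [lift_id, lift_id] at h2
      exact h2.trans_lt hκ
    · refine ⟨⊤, fun i u => ElementarySubstructure.mem_top _, ?_⟩
      refine lt_of_le_of_lt ?_ hκ
      exact (mk_subtype_le _).trans h
  let b : ℕ → Fin k → N := fun i u => j (a i u)
  have hb : ∀ i i', i < i' → R.Realize (Sum.elim (b i) (b i')) := by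
    intro i i' h
    have := (j.map_formula R (Sum.elim (a i) (a i'))).2 (ha i i' h)
    rwa [Sum.comp_elim] at this
  let U : Ultrafilter (Fin k → N) := (hyperfilter ℕ).map b
  have hU : ∀ᶠ x in (U : Filter (Fin k → N)), ∀ i, x i ∈ M :=
    Eventually.of_forall (f := (hyperfilter ℕ : Filter ℕ)) fun i u => haM i u
  have hev : ∀ {P : (Fin k → N) → Prop} (i : ℕ), (∀ i' > i, P (b i')) →
      ∀ᶠ x in (U : Filter (Fin k → N)), P x := by
    intro P i h
    refine (?_ : ∀ᶠ n in (hyperfilter ℕ : Filter ℕ), P (b n))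
    have : ∀ᶠ n in (hyperfilter ℕ : Filter ℕ), i < n :=
      Nat.hyperfilter_le_atTop (eventually_gt_atTop i)
    exact this.mono h
  obtain ⟨d, hd⟩ := hN.exists_realizesLimit U (A := M) hM
  obtain ⟨s, h0, hs⟩ := hN.exists_sequence hω hM U d
  have hreal : ∀ i, RealizesLimit L U ((M : Set N) ∪ entriesBelow s i) (s i) := by
    intro i
    rcases i with _ | i
    · rw [h0]
      refine hd.mono ?_
      rintro y (hy | ⟨j', hj', -⟩)
      · exact hy
      · exact absurd hj' (Nat.not_lt_zero _)
    · exact hs i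
  have hchain : ∀ i n, R.Realize (Sum.elim (b n) (s i)) := by
    intro i n
    have h1 := (hreal i).realize_iff (reverseRel R) (c := b n) fun u => Or.inl (haM n u)
    simp only [realize_reverseRel] at h1
    exact h1.2 (hev n fun i' hi' => hb n i' hi')
  have hR : ∀ i i', i < i' → R.Realize (Sum.elim (s i') (s i)) := by
    intro i i' h
    refine ((hreal i').realize_iff R (c := s i) fun u => Or.inr ⟨i, h, u, rfl⟩).2 ?_
    exact hev 0 fun n _ => hchain i n
  have htype : ∀ i i', typeOver (L := L) (M : Set N) (s i) = typeOver (M : Set N) (s i') :=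
    fun i i' => ((hreal i).mono Set.subset_union_left).typeOver_eq
      ((hreal i').mono Set.subset_union_left)
  have hsymm : ∀ A B : Set N, A.Countable → B.Countable → ConantIndep M A B → ConantIndep M B A :=
    fun A B hA hB h => hT (Theory.ModelType.of T N) κ hκ hN M hM A B
      ((le_aleph0_iff_set_countable.2 hA).trans_lt hω)
      ((le_aleph0_iff_set_countable.2 hB).trans_lt hω) h
  let D : ℕ → Set N := fun i => Set.range (s i)
  have hD : ∀ i, (D i).Countable := fun i => Set.countable_range _
  have hsub : ∀ {i i'}, i' < i → D i' ⊆ entriesBelow s i := by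
    rintro i i' h _ ⟨u, rfl⟩
    exact ⟨i', h, u, rfl⟩
  have hadd : ∀ {A B : Set N} (i : ℕ), A ∪ B ⊆ entriesBelow s i → ConantIndep M A B →
      ConantIndep M (A ∪ D i) B := fun i hAB h =>
    h.union_range hU ((hreal i).mono (Set.union_subset_union_right _ hAB))
  -- The terms are added one by one, alternately to the two sides.
  have i1 : ConantIndep M (D 1) (D 0) := by
    have := hadd (A := ∅) (B := D 0) 1 (by simpa using hsub Nat.one_pos)
      (conantIndep_empty hN hω hM _)
    simpa using this
  have i2 : ConantIndep M (D 0 ∪ D 2) (D 1) :=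
    hadd 2 (Set.union_subset (hsub (by norm_num)) (hsub (by norm_num)))
      (hsymm _ _ (hD 1) (hD 0) i1)
  have i3 : ConantIndep M (D 1 ∪ D 3) (D 0 ∪ D 2) :=
    hadd 3 (Set.union_subset (hsub (by norm_num)) (Set.union_subset (hsub (by norm_num))
      (hsub (by norm_num)))) (hsymm _ _ ((hD 0).union (hD 2)) (hD 1) i2)
  have i4 : ConantIndep M (D 0 ∪ D 2 ∪ D 4) (D 1 ∪ D 3) :=
    hadd 4 (Set.union_subset (Set.union_subset (hsub (by norm_num)) (hsub (by norm_num)))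
      (Set.union_subset (hsub (by norm_num)) (hsub (by norm_num))))
      (hsymm _ _ ((hD 1).union (hD 3)) ((hD 0).union (hD 2)) i3)
  have i5 := hsymm _ _ (((hD 0).union (hD 2)).union (hD 4)) ((hD 1).union (hD 3)) i4
  have e1 : D 1 ∪ D 3 = D 3 ∪ D 1 := Set.union_comm _ _
  have e2 : D 0 ∪ D 2 ∪ D 4 = D 4 ∪ D 2 ∪ D 0 := by
    rw [Set.union_comm (D 0), Set.union_right_comm, Set.union_comm (D 2)]
  rw [e1, e2] at i5
  obtain ⟨c, hc⟩ := exists_four_cycle_of_conantIndep R (hR 3 4 (by norm_num))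
    (hR 2 3 (by norm_num)) (hR 1 2 (by norm_num)) (hR 0 1 (by norm_num)) (htype 4 0) i5
  -- The cycle exists in `N₀` as well, which is elementarily equivalent to `N`.
  let χ : L.Formula (Fin (1 + 3) × Fin k) := Formula.iInf fun i : Fin (1 + 3) =>
    R.relabel (Sum.elim (fun u => (i, u)) fun u => (i + 1, u))
  have hχ : ∀ {K : Type (max u v)} [L.Structure K] (x : Fin (1 + 3) × Fin k → K),
      χ.Realize x ↔ ∀ i, R.Realize (Sum.elim (fun u => x (i, u)) fun u => x (i + 1, u)) := by
    intro K _ x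
    simp only [χ, Formula.realize_iInf, Formula.realize_relabel, Sum.comp_elim]
    rfl
  obtain ⟨x, hx⟩ := exists_realize_of_elementarilyEquivalent j.elementarilyEquivalent.symm χ
    ⟨fun q => c q.1 q.2, (hχ _).2 hc⟩
  exact hcycle ⟨fun i u => x (i, u), (hχ _).1 hx⟩

/-- `SOP_{n+1}` implies `SOP_n` for `n ≥ 3`: refine `R` by requiring an intermediate point. -/
theorem HasSOPAddThree.of_succ {T : L.Theory} {m : ℕ} (h : HasSOPAddThree T (m + 1)) :
    HasSOPAddThree T m := by
  obtain ⟨N, k, R, hcycle, a, ha⟩ := h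
  refine ⟨N, k, R ⊓ compRel R, ?_, fun i => a (2 * i), fun i j hij => ?_⟩
  · rintro ⟨x, hx⟩
    have h1 : ∀ i, R.Realize (Sum.elim (x i) (x (i + 1))) := fun i =>
      (Formula.realize_inf.1 (hx i)).1
    obtain ⟨z, hz1, hz2⟩ := (realize_compRel R _ _).1
      (Formula.realize_inf.1 (hx (Fin.last (m + 2)))).2
    rw [Fin.last_add_one] at hz2
    refine hcycle ⟨Fin.snoc (α := fun _ => Fin k → N) x z, fun i => ?_⟩
    refine Fin.lastCases ?_ (fun i => ?_) i
    · rw [Fin.last_add_one, Fin.snoc_last]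
      exact hz2
    · refine Fin.lastCases ?_ (fun i => ?_) i
      · have : (Fin.castSucc (Fin.last (m + 2)) + 1 : Fin (m + 1 + 3)) = Fin.last (m + 3) := by
          ext; simp
        rw [this, Fin.snoc_last, Fin.snoc_castSucc]
        exact hz1
      · have h2 := h1 i.castSucc
        have e1 : (i.castSucc + 1 : Fin (m + 3)) = i.succ := by
          rw [Fin.coeSucc_eq_succ]
        have e2 : (i.castSucc.castSucc + 1 : Fin (m + 1 + 3)) = i.succ.castSucc := by
          rw [Fin.coeSucc_eq_succ]; rfl
        rw [e1] at h2
        rw [e2, Fin.snoc_castSucc, Fin.snoc_castSucc]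
        exact h2
  · rw [Formula.realize_inf, realize_compRel]
    exact ⟨ha _ _ (by omega), a (2 * i + 1), ha _ _ (by omega), ha _ _ (by omega)⟩

theorem HasSOPAddThree.of_le {T : L.Theory} {m n : ℕ} (hmn : m ≤ n) (h : HasSOPAddThree T n) :
    HasSOPAddThree T m := by
  induction hmn with
  | refl => exact h
  | step _ ih => exact ih h.of_succ

end Symmetric

/-! ### Generic triangle-free graphs -/

section GenericGraph

/-- The language of graphs, with one binary relation symbol, in arbitrary universes. -/
def edgeLanguage : FirstOrder.Language.{u, v} :=
  ⟨fun _ => PEmpty.{u + 1}, fun n => ULift.{v} (PLift (n = 2))⟩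

/-- The edge relation symbol. -/
def edgeSymbol : edgeLanguage.{u, v}.Relations 2 := ⟨⟨rfl⟩⟩

/-- The edge relation of a structure in the language of graphs. -/
def Adj {N : Type*} [edgeLanguage.{u, v}.Structure N] (x y : N) : Prop :=
  Structure.RelMap edgeSymbol.{u, v} ![x, y]

/-- The formula expressing an edge between two variables. -/
def adjFormula {α : Type*} (i j : α) : edgeLanguage.{u, v}.Formula α :=
  edgeSymbol.{u, v}.formula₂ (Term.var i) (Term.var j)

/-- The formula expressing the equality of two variables. -/
def eqFormula {L : FirstOrder.Language.{u, v}} {α : Type*} (i j : α) : L.Formula α :=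
  Term.equal (Term.var i) (Term.var j)

@[simp] theorem realize_eqFormula {L : FirstOrder.Language.{u, v}} {α N : Type*} [L.Structure N]
    (i j : α) (v : α → N) : (eqFormula i j : L.Formula α).Realize v ↔ v i = v j := by
  simp [eqFormula, Formula.realize_equal]

variable {N : Type*} [edgeLanguage.{u, v}.Structure N]

@[simp] theorem realize_adjFormula {α : Type*} (i j : α) (v : α → N) :
    (adjFormula.{u, v} i j).Realize v ↔ Adj (v i) (v j) := by
  simp [adjFormula, Adj, Formula.realize_rel₂]

variable (N) in
/-- A triangle-free graph in which all finite configurations compatible with triangle-freeness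
occur: every independent subset `A` of a finite set `C` is the set of neighbours in `C` of some
vertex outside `C`. -/
structure IsGeneric : Prop where
  symm : ∀ x y : N, Adj x y → Adj y x
  irrefl : ∀ x : N, ¬ Adj x x
  triangle_free : ∀ x y z : N, Adj x y → Adj y z → ¬ Adj x z
  extension : ∀ A C : Finset N, A ⊆ C → (∀ x ∈ A, ∀ y ∈ A, ¬ Adj x y) →
    ∃ z, z ∉ C ∧ ∀ c ∈ C, Adj z c ↔ c ∈ A

/-- The tuples `a` and `b` satisfy the same atomic formulas. -/
def SameAtomic {β : Type*} (a b : β → N) : Prop :=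
  ∀ i j, (a i = a j ↔ b i = b j) ∧ (Adj (a i) (a j) ↔ Adj (b i) (b j))

theorem SameAtomic.symm {β : Type*} {a b : β → N} (h : SameAtomic a b) : SameAtomic b a :=
  fun i j => ⟨(h i j).1.symm, (h i j).2.symm⟩

theorem IsGeneric.adj_comm (hN : IsGeneric N) {x y : N} : Adj x y ↔ Adj y x :=
  ⟨hN.symm x y, hN.symm y x⟩

/-- For pairs of tuples it suffices to compare the entries within and across the two tuples. -/
theorem IsGeneric.sameAtomic_elim (hN : IsGeneric N) {β γ : Type*} {a a' : β → N} {c c' : γ → N}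
    (ha : SameAtomic a a') (hc : SameAtomic c c')
    (hac : ∀ i j, (a i = c j ↔ a' i = c' j) ∧ (Adj (a i) (c j) ↔ Adj (a' i) (c' j))) :
    SameAtomic (Sum.elim a c) (Sum.elim a' c') := by
  rintro (i | i) (j | j)
  · exact ha i j
  · exact hac i j
  · have := hac j i
    simp only [Sum.elim_inl, Sum.elim_inr]
    rw [eq_comm, this.1, eq_comm, hN.adj_comm, this.2, hN.adj_comm]
    exact ⟨Iff.rfl, Iff.rfl⟩
  · exact hc i j

/-- The back-and-forth step. -/
theorem IsGeneric.exists_extend (hN : IsGeneric N) {β : Type*} [Finite β] {a b : β → N}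
    (h : SameAtomic a b) (x : N) :
    ∃ y, SameAtomic (fun o : Option β => o.elim x a) (fun o => o.elim y b) := by
  classical
  by_cases hx : ∃ i, a i = x
  · obtain ⟨i, rfl⟩ := hx
    refine ⟨b i, ?_⟩
    rintro (_ | j) (_ | k) <;> exact h _ _
  · push Not at hx
    have := Fintype.ofFinite β
    obtain ⟨y, hy, hadj⟩ := hN.extension ((Finset.univ.filter fun i => Adj x (a i)).image b)
      (Finset.univ.image b) (Finset.image_subset_image (Finset.filter_subset _ _)) (by
        simp only [Finset.mem_image, Finset.mem_filter, Finset.mem_univ, true_and]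
        rintro _ ⟨i, hi, rfl⟩ _ ⟨j, hj, rfl⟩ hij
        exact hN.triangle_free _ _ _ hi ((h i j).2.2 hij) hj)
    have hyb : ∀ i, b i ≠ y := fun i hi => hy (by rw [← hi]; simp)
    have hadj' : ∀ i, Adj x (a i) ↔ Adj y (b i) := by
      intro i
      rw [hadj _ (by simp)]
      simp only [Finset.mem_image, Finset.mem_filter, Finset.mem_univ, true_and]
      refine ⟨fun hi => ⟨i, hi, rfl⟩, ?_⟩
      rintro ⟨j, hj, hij⟩
      rwa [← ((h j i).1.2 hij)]
    refine ⟨y, ?_⟩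
    rintro (_ | j) (_ | k)
    · exact ⟨by simp, iff_of_false (hN.irrefl _) (hN.irrefl _)⟩
    · exact ⟨iff_of_false (fun e => hx k e.symm) (fun e => hyb k e.symm), hadj' k⟩
    · refine ⟨iff_of_false (hx j) (hyb j), ?_⟩
      simp only [Option.elim_none, Option.elim_some]
      rw [hN.adj_comm, hadj', hN.adj_comm]
    · exact h j k

theorem exists_eq_var {β : Type*} (t : edgeLanguage.{u, v}.Term β) : ∃ i, t = Term.var i := by
  cases t with
  | var i => exact ⟨i, rfl⟩
  | func f _ => exact f.elim

theorem IsGeneric.realize_iff_aux (hN : IsGeneric N) {α : Type*} [Finite α] {n : ℕ}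
    (φ : edgeLanguage.{u, v}.BoundedFormula α n) :
    ∀ (v w : α → N) (xs ys : Fin n → N), SameAtomic (Sum.elim v xs) (Sum.elim w ys) →
      (φ.Realize v xs ↔ φ.Realize w ys) := by
  induction φ with
  | falsum => intro v w xs ys _; exact Iff.rfl
  | equal t₁ t₂ =>
    intro v w xs ys h
    obtain ⟨i, rfl⟩ := exists_eq_var t₁
    obtain ⟨j, rfl⟩ := exists_eq_var t₂
    exact (h i j).1
  | rel R ts =>
    intro v w xs ys h
    obtain ⟨⟨rfl⟩⟩ := R
    obtain ⟨i, hi⟩ := exists_eq_var (ts 0)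
    obtain ⟨j, hj⟩ := exists_eq_var (ts 1)
    have e : ∀ z : α ⊕ Fin _ → N, (fun k => (ts k).realize z) = ![z i, z j] := by
      intro z
      funext k
      fin_cases k
      · simp [hi]
      · simp [hj]
    simp only [BoundedFormula.Realize, e]
    exact (h i j).2
  | imp _ _ ih₁ ih₂ =>
    intro v w xs ys h
    exact imp_congr (ih₁ v w xs ys h) (ih₂ v w xs ys h)
  | @all m φ ih =>
    intro v w xs ys h
    let ρ : α ⊕ Fin (m + 1) → Option (α ⊕ Fin m) := Sum.elim (fun i => some (Sum.inl i))
      (Fin.snoc (α := fun _ => Option (α ⊕ Fin m)) (fun k => some (Sum.inr k)) none)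
    have e : ∀ (v : α → N) (xs : Fin m → N) (x : N), Sum.elim v (Fin.snoc xs x : Fin (m + 1) → N) =
        (fun o : Option (α ⊕ Fin m) => o.elim x (Sum.elim v xs)) ∘ ρ := by
      intro v xs x
      funext k
      rcases k with k | k
      · rfl
      · refine Fin.lastCases ?_ (fun k => ?_) k <;> simp [ρ]
    have step : ∀ (v w : α → N) (xs ys : Fin m → N), SameAtomic (Sum.elim v xs) (Sum.elim w ys) →
        (∀ x : N, φ.Realize v (Fin.snoc xs x)) → ∀ y : N, φ.Realize w (Fin.snoc ys y) := by
      intro v w xs ys h hall y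
      obtain ⟨x, hx⟩ := hN.exists_extend h.symm y
      refine (ih w v _ _ ?_).2 (hall x)
      rw [e, e]
      exact fun i j => hx (ρ i) (ρ j)
    exact ⟨step v w xs ys h, step w v ys xs h.symm⟩

/-- Quantifier elimination: the formulas true of a finite tuple are determined by its atomic
formulas. -/
theorem IsGeneric.realize_iff (hN : IsGeneric N) {α : Type*} [Finite α] {a b : α → N}
    (h : SameAtomic a b) (φ : edgeLanguage.{u, v}.Formula α) : φ.Realize a ↔ φ.Realize b := by
  refine hN.realize_iff_aux φ a b _ _ ?_
  rintro (i | i) (j | j)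
  · exact h i j
  · exact j.elim0
  · exact i.elim0
  · exact i.elim0

/-- A finite triangle-free graph `Y` (a subgraph of `N`) has a copy outside a finite set `C` with
prescribed edges to `C`, as long as the prescription creates no triangles. -/
theorem IsGeneric.exists_copy (hN : IsGeneric N) (C : Finset N) (K : N → N → Prop) (Y : Finset N) :
    (∀ y ∈ Y, ∀ y' ∈ Y, ∀ c ∈ C, Adj y y' → K y c → ¬ K y' c) →
    (∀ y ∈ Y, ∀ c ∈ C, ∀ c' ∈ C, K y c → K y c' → ¬ Adj c c') →
    ∃ g : N → N, Set.InjOn g Y ∧ (∀ y ∈ Y, g y ∉ C) ∧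
      (∀ y ∈ Y, ∀ y' ∈ Y, Adj (g y) (g y') ↔ Adj y y') ∧
      ∀ y ∈ Y, ∀ c ∈ C, Adj (g y) c ↔ K y c := by
  classical
  induction Y using Finset.induction_on with
  | empty => intro _ _; exact ⟨id, by simp⟩
  | insert y₀ Y hy₀ ih =>
    intro h1 h2
    obtain ⟨g, hinj, hC, hadj, hK⟩ := ih
      (fun y hy y' hy' => h1 y (Finset.mem_insert_of_mem hy) y' (Finset.mem_insert_of_mem hy'))
      (fun y hy => h2 y (Finset.mem_insert_of_mem hy))
    have hmem := Finset.mem_insert_self y₀ Y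
    obtain ⟨x, hx, hxadj⟩ := hN.extension
      (C.filter (K y₀) ∪ (Y.filter (Adj y₀)).image g) (C ∪ Y.image g)
      (Finset.union_subset_union (Finset.filter_subset _ _)
        (Finset.image_subset_image (Finset.filter_subset _ _))) (by
        simp only [Finset.mem_union, Finset.mem_filter, Finset.mem_image]
        rintro p (⟨hp, hpK⟩ | ⟨y, ⟨hy, hyy⟩, rfl⟩) q (⟨hq, hqK⟩ | ⟨y', ⟨hy', hyy'⟩, rfl⟩) hpq
        · exact h2 y₀ hmem p hp q hq hpK hqK hpq
        · rw [hN.adj_comm, hK y' hy' p hp] at hpq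
          exact h1 y₀ hmem y' (Finset.mem_insert_of_mem hy') p hp hyy' hpK hpq
        · rw [hK y hy q hq] at hpq
          exact h1 y₀ hmem y (Finset.mem_insert_of_mem hy) q hq hyy hqK hpq
        · rw [hadj y hy y' hy'] at hpq
          exact hN.triangle_free _ _ _ hyy hpq hyy')
    have hne : ∀ y ∈ Y, y ≠ y₀ := fun y hy e => hy₀ (e ▸ hy)
    have hg : ∀ y ∈ Y, Function.update g y₀ x y = g y := fun y hy =>
      Function.update_of_ne (hne y hy) _ _
    have hg₀ : Function.update g y₀ x y₀ = x := Function.update_self _ _ _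
    have hxC : x ∉ C := fun h => hx (Finset.mem_union_left _ h)
    have hxY : ∀ y ∈ Y, g y ≠ x := fun y hy e =>
      hx (Finset.mem_union_right _ (e ▸ Finset.mem_image_of_mem g hy))
    have hx1 : ∀ c ∈ C, Adj x c ↔ K y₀ c := by
      intro c hc
      rw [hxadj c (Finset.mem_union_left _ hc), Finset.mem_union, Finset.mem_filter]
      refine ⟨?_, fun h => Or.inl ⟨hc, h⟩⟩
      rintro (h | h)
      · exact h.2
      · obtain ⟨y, hy, rfl⟩ := Finset.mem_image.1 h
        exact absurd hc (hC y (Finset.mem_filter.1 hy).1)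
    have hx2 : ∀ y ∈ Y, Adj x (g y) ↔ Adj y₀ y := by
      intro y hy
      rw [hxadj _ (Finset.mem_union_right _ (Finset.mem_image_of_mem g hy)), Finset.mem_union,
        Finset.mem_filter, Finset.mem_image]
      refine ⟨?_, fun h => Or.inr ⟨y, Finset.mem_filter.2 ⟨hy, h⟩, rfl⟩⟩
      rintro (h | ⟨y', hy', e⟩)
      · exact absurd h.1 (hC y hy)
      · rw [Finset.mem_filter] at hy'
        rw [← hinj hy'.1 hy e]
        exact hy'.2
    refine ⟨Function.update g y₀ x, ?_, ?_, ?_, ?_⟩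
    · intro y hy y' hy' e
      rcases Finset.mem_insert.1 hy with rfl | h <;> rcases Finset.mem_insert.1 hy' with rfl | h'
      · rfl
      · rw [hg₀, hg _ h'] at e; exact absurd e.symm (hxY _ h')
      · rw [hg₀, hg _ h] at e; exact absurd e (hxY _ h)
      · rw [hg _ h, hg _ h'] at e; exact hinj h h' e
    · intro y hy
      rcases Finset.mem_insert.1 hy with rfl | hy
      · rwa [hg₀]
      · rw [hg _ hy]; exact hC y hy
    · intro y hy y' hy'
      rcases Finset.mem_insert.1 hy with rfl | h <;> rcases Finset.mem_insert.1 hy' with rfl | h'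
      · exact iff_of_false (hN.irrefl _) (hN.irrefl _)
      · rw [hg₀, hg _ h']; exact hx2 _ h'
      · rw [hg₀, hg _ h, hN.adj_comm, hx2 _ h, hN.adj_comm]
      · rw [hg _ h, hg _ h']; exact hadj _ h _ h'
    · intro y hy c hc
      rcases Finset.mem_insert.1 hy with rfl | hy
      · rw [hg₀]; exact hx1 c hc
      · rw [hg _ hy]; exact hK y hy c hc

/-- The tuple `a'` is a copy of `a` over the set `P` which is free from the finite set `C`: its
entries outside `P` are not in `C`, and adjacent to no element of `C` outside `P`. -/
structure IsFreeCopy (P : Set N) (C : Finset N) {n : ℕ} (a a' : Fin n → N) : Prop where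
  eq_of_mem : ∀ l, a l ∈ P → a' l = a l
  notMem : ∀ l, a l ∉ P → a' l ∉ C
  adj_iff : ∀ l, a l ∉ P → ∀ c ∈ C, Adj (a' l) c ↔ c ∈ P ∧ Adj (a l) c
  sameAtomic : SameAtomic a' a

theorem IsFreeCopy.mono {P : Set N} {C C' : Finset N} {n : ℕ} {a a' : Fin n → N}
    (h : IsFreeCopy P C a a') (hC : C' ⊆ C) : IsFreeCopy P C' a a' :=
  ⟨h.eq_of_mem, fun l hl hc => h.notMem l hl (hC hc), fun l hl c hc => h.adj_iff l hl c (hC hc),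
    h.sameAtomic⟩

theorem IsGeneric.exists_isFreeCopy (hN : IsGeneric N) (P : Set N) (C : Finset N) {n : ℕ}
    (a : Fin n → N) : ∃ a', IsFreeCopy P C a a' := by
  classical
  obtain ⟨g, hinj, hC, hadj, hK⟩ := hN.exists_copy (C ∪ (Finset.univ.image a).filter (· ∈ P))
    (fun y c => c ∈ P ∧ Adj y c) ((Finset.univ.image a).filter (· ∉ P))
    (fun y _ y' _ c _ h1 h2 h3 => hN.triangle_free _ _ _ h1 h3.2 h2.2)
    (fun y _ c _ c' _ h1 h2 h3 => hN.triangle_free _ _ _ h1.2 h3 h2.2)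
  have hY : ∀ l, a l ∉ P → a l ∈ (Finset.univ.image a).filter (· ∉ P) := fun l hl =>
    Finset.mem_filter.2 ⟨by simp, hl⟩
  have hP : ∀ l, a l ∈ P → a l ∈ C ∪ (Finset.univ.image a).filter (· ∈ P) := fun l hl =>
    Finset.mem_union_right _ (Finset.mem_filter.2 ⟨by simp, hl⟩)
  refine ⟨fun l => if a l ∈ P then a l else g (a l), ?_, ?_, ?_, ?_⟩
  · intro l hl
    simp only [if_pos hl]
  · intro l hl hc
    simp only [if_neg hl] at hc
    exact hC _ (hY l hl) (Finset.mem_union_left _ hc)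
  · intro l hl c hc
    simp only [if_neg hl]
    exact hK _ (hY l hl) c (Finset.mem_union_left _ hc)
  · intro l l'
    by_cases hl : a l ∈ P <;> by_cases hl' : a l' ∈ P <;> simp only [hl, hl', if_true, if_false]
    · simp
    · refine ⟨iff_of_false (fun e => hC _ (hY l' hl') (e ▸ hP l hl)) fun e => hl' (e ▸ hl), ?_⟩
      rw [hN.adj_comm, hK _ (hY l' hl') _ (hP l hl), hN.adj_comm]
      exact and_iff_right hl
    · refine ⟨iff_of_false (fun e => hC _ (hY l hl) (e ▸ hP l' hl')) fun e => hl (e ▸ hl'), ?_⟩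
      rw [hK _ (hY l hl) _ (hP l' hl')]
      exact and_iff_right hl'
    · exact ⟨⟨fun e => hinj (hY l hl) (hY l' hl') e, fun e => by rw [e]⟩,
        hadj _ (hY l hl) _ (hY l' hl')⟩

end GenericGraph

/-! ### Conant-independence in generic triangle-free graphs -/

section Disjointness

/-- Conant-independent sets meet inside `M` only: for `e ∉ M` the formula `x = e` Conant-divides,
since an invariant type containing `x = e` would contain `x = e'` for every conjugate `e'` of `e`
over `M`. -/
theorem ConantIndep.mem_of_mem {L : FirstOrder.Language.{u, v}} {N : Type (max u v)}
    [L.Structure N] [Nonempty N] {κ : Cardinal.{max u v}} (hN : IsSaturated L N κ) (hκ : ℵ₀ < κ)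
    {M : L.ElementarySubstructure N} (hM : #M < κ) {A B : Set N} (h : ConantIndep M A B) {e : N}
    (hA : e ∈ A) (hB : e ∈ B) : e ∈ M := by
  by_contra heM
  let c : Fin 1 → N := fun _ => e
  let φ : L.Formula (Fin 1 ⊕ Fin 1) := eqFormula (Sum.inl 0) (Sum.inr 0)
  have hφ : ∀ x y : Fin 1 → N, φ.Realize (Sum.elim x y) ↔ x 0 = y 0 := by
    intro x y
    simp [φ]
  refine h 1 1 φ c c (fun _ => hA) (fun _ => Or.inr hB) ((hφ _ _).2 rfl)
    ⟨1, fun _ => 1, fun _ => φ, fun _ => c, fun _ => ?_, fun a ha => ⟨0, ha⟩⟩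
  rintro s ⟨p, hinv, hp⟩ h0
  refine ⟨{0, 1}, ?_⟩
  rintro ⟨a, ha⟩
  have h1 : s 1 0 = e := by
    have e0 := (hφ _ _).1 (ha 0 (by simp))
    have e1 := (hφ _ _).1 (ha 1 (by simp))
    rw [← e1, e0, h0]
  have h2 : p.HasFormula φ c := ((hp 1).hasFormula_iff φ fun j =>
    Or.inr ⟨0, Nat.one_pos, 0, by rw [h0]⟩).2 ((hφ _ _).2 h1)
  obtain ⟨U, hUM, hU⟩ := exists_finitelySatisfiable_extension M c
  obtain ⟨c', hc'⟩ := hN.exists_realizesLimit U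
    (mk_union_lt_of_countable hκ hM (Set.countable_singleton e))
  have hne : c' 0 ≠ e := by
    intro h3
    have h4 := (hc'.realize_iff φ (c := c) fun _ => Or.inr rfl).1 ((hφ _ _).2 h3)
    obtain ⟨x, hx, hxM⟩ := (h4.and hUM).exists
    rw [hφ] at hx
    have hx' : x 0 = e := hx
    exact heM (hx' ▸ hxM 0)
  have h5 := (hinv 1 φ c c' (hU.typeOver_eq (hc'.mono Set.subset_union_left))).1 h2
  obtain ⟨V, hV⟩ := p.exists_ultrafilter
  rw [hV] at h2 h5
  obtain ⟨x, hx1, hx2⟩ := (h2.and h5).exists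
  rw [hφ] at hx1 hx2
  exact hne (hx2.symm.trans hx1)

end Disjointness

section GenericIndependence

variable {N : Type (max u v)} [edgeLanguage.{u, v}.Structure N] [Nonempty N]
  {M : edgeLanguage.{u, v}.ElementarySubstructure N}

omit [Nonempty N] in
/-- Free copies of `d` over `P` from all finite sets `C` at once, in the limit along an
ultrafilter. -/
theorem IsGeneric.exists_freeLimit (hN : IsGeneric N) (P : Set N) {n : ℕ} (d : Fin n → N) :
    ∃ U : Ultrafilter (Fin n → N), ∀ C : Finset N,
      ∀ᶠ x in (U : Filter (Fin n → N)), IsFreeCopy P C d x :=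
  exists_ultrafilter_of_finite_inter (fun C : Finset N => {x | IsFreeCopy P C d x}) fun F => by
    classical
    obtain ⟨x, hx⟩ := hN.exists_isFreeCopy P (F.sup id) d
    exact ⟨x, fun C hC => hx.mono (Finset.le_sup (f := id) hC)⟩

/-- The limit of free copies over `M` is invariant over `M`. -/
theorem IsGeneric.invariantLimit_free (hN : IsGeneric N) {n : ℕ} {d : Fin n → N}
    {U : Ultrafilter (Fin n → N)} (hU : ∀ C : Finset N,
      ∀ᶠ x in (U : Filter (Fin n → N)), IsFreeCopy (M : Set N) C d x) : InvariantLimit M U := by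
  classical
  intro k φ c c' hcc h
  have heq : ∀ m ∈ M, ∀ j, c j = m ↔ c' j = m := by
    intro m hm j
    have := realize_iff_of_typeOver_eq hcc (eqFormula (Sum.inl j) (Sum.inr 0))
      (c := fun _ : Fin 1 => m) fun _ => hm
    simpa using this
  have hadj : ∀ m ∈ M, ∀ j, Adj (c j) m ↔ Adj (c' j) m := by
    intro m hm j
    have := realize_iff_of_typeOver_eq hcc (adjFormula (Sum.inl j) (Sum.inr 0))
      (c := fun _ : Fin 1 => m) fun _ => hm
    simpa using this
  have hsame : SameAtomic c c' := by
    intro i j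
    have h1 := realize_iff_of_typeOver_eq hcc (eqFormula (Sum.inl i) (Sum.inl j))
      (c := fun i : Fin 0 => i.elim0) fun i => i.elim0
    have h2 := realize_iff_of_typeOver_eq hcc (adjFormula (Sum.inl i) (Sum.inl j))
      (c := fun i : Fin 0 => i.elim0) fun i => i.elim0
    exact ⟨by simpa using h1, by simpa using h2⟩
  filter_upwards [h, hU (Finset.univ.image c ∪ Finset.univ.image c')] with x hx hfree
  have hc : ∀ j, c j ∈ Finset.univ.image c ∪ Finset.univ.image c' := fun j => by simp
  have hc' : ∀ j, c' j ∈ Finset.univ.image c ∪ Finset.univ.image c' := fun j => by simp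
  refine (hN.realize_iff (hN.sameAtomic_elim (fun i j => ⟨Iff.rfl, Iff.rfl⟩) hsame
    fun l j => ?_) φ).1 hx
  by_cases hl : d l ∈ M
  · rw [hfree.eq_of_mem l hl, eq_comm, heq _ hl, eq_comm, hN.adj_comm, hadj _ hl, hN.adj_comm]
    exact ⟨Iff.rfl, Iff.rfl⟩
  · refine ⟨iff_of_false (fun e => hfree.notMem l hl (e ▸ hc j))
      (fun e => hfree.notMem l hl (e ▸ hc' j)), ?_⟩
    rw [hfree.adj_iff l hl _ (hc j), hfree.adj_iff l hl _ (hc' j)]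
    constructor
    · rintro ⟨h1, h2⟩
      rw [(heq _ h1 j).1 rfl]
      exact ⟨h1, h2⟩
    · rintro ⟨h1, h2⟩
      rw [(heq _ h1 j).2 rfl]
      exact ⟨h1, h2⟩

/-- The properties of a Morley sequence of copies of `d` which are free over `M`. -/
structure IsFreeSequence (M : Set N) {n : ℕ} (d : Fin n → N) (s : ℕ → Fin n → N) : Prop where
  sameAtomic : ∀ i, SameAtomic (s i) d
  eq_of_mem : ∀ i t, d t ∈ M → s i t = d t
  mem_iff : ∀ i t, s i t ∈ M ↔ d t ∈ M
  adj_iff : ∀ i t, ∀ m ∈ M, Adj (s i t) m ↔ Adj (d t) m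
  ne : ∀ i i', i < i' → ∀ t t', d t' ∉ M → s i' t' ≠ s i t
  mem_of_adj : ∀ i i', i < i' → ∀ t t', d t' ∉ M → Adj (s i' t') (s i t) → s i t ∈ M

/-- Every tuple starts an invariant Morley sequence which is free over `M`. -/
theorem IsGeneric.exists_freeSequence (hN : IsGeneric N) {κ : Cardinal.{max u v}}
    (hsat : IsSaturated edgeLanguage.{u, v} N κ) (hκ : ℵ₀ < κ) (hM : #M < κ) {n : ℕ}
    (d : Fin n → N) : ∃ s : ℕ → Fin n → N, s 0 = d ∧
      IsInvariantMorleySequence (L := edgeLanguage.{u, v}) M s ∧ IsFreeSequence (M : Set N) d s := by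
  classical
  obtain ⟨U, hU⟩ := hN.exists_freeLimit (M : Set N) d
  obtain ⟨s, h0, hs⟩ := hsat.exists_sequence hκ hM U d
  have hmor : IsInvariantMorleySequence (L := edgeLanguage.{u, v}) M s := by
    refine isInvariantMorleySequence_of_realizesLimit (hN.invariantLimit_free hU)
      (fun k φ c hc h => ?_) hs
    rw [h0]
    obtain ⟨x, hx, hfree⟩ := (h.and (hU (Finset.univ.image c))).exists
    have hc' : ∀ j, c j ∈ Finset.univ.image c := fun j => by simp
    refine (hN.realize_iff (hN.sameAtomic_elim hfree.sameAtomic (fun i j => ⟨Iff.rfl, Iff.rfl⟩)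
      fun l j => ?_) φ).1 hx
    by_cases hl : d l ∈ (M : Set N)
    · rw [hfree.eq_of_mem l hl]
      exact ⟨Iff.rfl, Iff.rfl⟩
    · refine ⟨iff_of_false (fun e => hfree.notMem l hl (e ▸ hc' j))
        (fun e => hl (e ▸ hc j)), ?_⟩
      rw [hfree.adj_iff l hl _ (hc' j)]
      exact and_iff_right (hc j)
  refine ⟨s, h0, hmor, fun i a b => ?_, fun i t ht => ?_, fun i t => ?_, fun i t m hm => ?_,
    fun i i' hi t t' ht' => ?_, fun i i' hi t t' ht' h => ?_⟩
  · have h1 := hmor.realize_iff (eqFormula (Sum.inl a) (Sum.inl b))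
      (c := fun i : Fin 0 => i.elim0) (fun i => i.elim0) i 0
    have h2 := hmor.realize_iff (adjFormula (Sum.inl a) (Sum.inl b))
      (c := fun i : Fin 0 => i.elim0) (fun i => i.elim0) i 0
    rw [h0] at h1 h2
    exact ⟨by simpa using h1, by simpa using h2⟩
  · have := hmor.eq_of_mem (i := 0) (i' := i) (t := t) (by rw [h0]; exact ht)
    rw [this, h0]
  · constructor
    · intro h
      have := hmor.eq_of_mem (i := i) (i' := 0) (t := t) h
      rw [h0] at this
      rwa [this]
    · intro h
      have := hmor.eq_of_mem (i := 0) (i' := i) (t := t) (by rw [h0]; exact h)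
      rw [this, h0]
      exact h
  · have := hmor.realize_iff (adjFormula (Sum.inl t) (Sum.inr 0))
      (c := fun _ : Fin 1 => m) (fun _ => hm) i 0
    rw [h0] at this
    simpa using this
  · obtain ⟨i', rfl⟩ : ∃ k, i' = k + 1 := ⟨i' - 1, by omega⟩
    intro e
    have h1 := ((hs i').realize_iff (eqFormula (Sum.inl t') (Sum.inr 0))
      (c := fun _ : Fin 1 => s i t) fun _ => Or.inr ⟨i, hi, t, rfl⟩).1 (by simpa using e)
    obtain ⟨x, hx, hfree⟩ := (h1.and (hU {s i t})).exists
    exact hfree.notMem t' ht' (by simpa using hx)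
  · obtain ⟨i', rfl⟩ : ∃ k, i' = k + 1 := ⟨i' - 1, by omega⟩
    have h1 := ((hs i').realize_iff (adjFormula (Sum.inl t') (Sum.inr 0))
      (c := fun _ : Fin 1 => s i t) fun _ => Or.inr ⟨i, hi, t, rfl⟩).1 (by simpa using h)
    obtain ⟨x, hx, hfree⟩ := (h1.and (hU {s i t})).exists
    exact ((hfree.adj_iff t' ht' _ (by simp)).1 (by simpa using hx)).1

section FreeSequence

omit [Nonempty N]

variable {P : Set N} {n : ℕ} {d : Fin n → N} {s : ℕ → Fin n → N}

theorem IsFreeSequence.eq_of_eq (h : IsFreeSequence P d s) {i i' : ℕ} {t t' : Fin n}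
    (e : s i t = s i' t') : d t = d t' := by
  have key : ∀ i i', i < i' → ∀ t t', s i t = s i' t' → d t = d t' := by
    intro i i' hi t t' e
    have ht' : d t' ∈ P := by
      by_contra hn
      exact h.ne i i' hi t t' hn e.symm
    have h1 := h.eq_of_mem i' t' ht'
    have ht : d t ∈ P := by rwa [← h.mem_iff i t, e, h1]
    rw [← h.eq_of_mem i t ht, e, h1]
  rcases lt_trichotomy i i' with hi | rfl | hi
  · exact key _ _ hi _ _ e
  · exact (h.sameAtomic i t t').1.1 e
  · exact (key _ _ hi _ _ e.symm).symm

theorem IsFreeSequence.adj_of_adj (h : IsFreeSequence P d s) (hN : IsGeneric N) {i i' : ℕ}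
    {t t' : Fin n} (e : Adj (s i t) (s i' t')) : Adj (d t) (d t') := by
  have key : ∀ i i', i < i' → ∀ t t', Adj (s i t) (s i' t') → Adj (d t) (d t') := by
    intro i i' hi t t' e
    by_cases ht' : d t' ∈ P
    · rw [h.eq_of_mem i' t' ht'] at e
      exact (h.adj_iff i t _ ht').1 e
    · have h1 := h.mem_of_adj i i' hi t t' ht' (hN.symm _ _ e)
      have ht := (h.mem_iff i t).1 h1
      rw [h.eq_of_mem i t ht, hN.adj_comm] at e
      exact hN.symm _ _ ((h.adj_iff i' t' _ ht).1 e)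
  rcases lt_trichotomy i i' with hi | rfl | hi
  · exact key _ _ hi _ _ e
  · exact (h.sameAtomic i t t').2.1 e
  · exact hN.symm _ _ (key _ _ hi _ _ (hN.symm _ _ e))

/-- Free amalgamation: if `a` meets `d` inside `M` only, then finitely many members of a free
sequence in the type of `d` admit a common tuple related to each of them as `a` is to `d`. -/
theorem IsFreeSequence.exists_amalgam (h : IsFreeSequence P d s) (hN : IsGeneric N) {m : ℕ}
    (a : Fin m → N) (had : ∀ l t, a l = d t → a l ∈ P) (F : Finset ℕ) :
    ∃ a' : Fin m → N, ∀ i ∈ F, SameAtomic (Sum.elim a' (s i)) (Sum.elim a d) := by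
  classical
  let C₁ : Finset N := F.biUnion fun i => Finset.univ.image (s i)
  let C : Finset N := C₁ ∪ (Finset.univ.image a).filter (· ∈ P)
  let Y : Finset N := (Finset.univ.image a).filter (· ∉ P)
  let K : N → N → Prop := fun y c => (∃ i t, c = s i t ∧ Adj y (d t)) ∨ (c ∈ P ∧ Adj y c)
  have hC : ∀ c ∈ C, (∃ i t, c = s i t) ∨ c ∈ P := by
    intro c hc
    rcases Finset.mem_union.1 hc with hc | hc
    · obtain ⟨i, -, hi⟩ := Finset.mem_biUnion.1 hc
      obtain ⟨t, -, ht⟩ := Finset.mem_image.1 hi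
      exact Or.inl ⟨i, t, ht.symm⟩
    · exact Or.inr (Finset.mem_filter.1 hc).2
  have hdP : ∀ i t, s i t ∈ P → d t = s i t := fun i t ht =>
    (h.eq_of_mem i t ((h.mem_iff i t).1 ht)).symm
  have hKs : ∀ y i t, K y (s i t) ↔ Adj y (d t) := by
    intro y i t
    refine ⟨?_, fun hy => Or.inl ⟨i, t, rfl, hy⟩⟩
    rintro (⟨i', t', e, hy⟩ | ⟨hP, hy⟩)
    · rwa [h.eq_of_eq e]
    · rwa [hdP i t hP]
  have hKP : ∀ y, ∀ c ∈ P, K y c ↔ Adj y c := by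
    intro y c hc
    refine ⟨?_, fun hy => Or.inr ⟨hc, hy⟩⟩
    rintro (⟨i, t, rfl, hy⟩ | ⟨-, hy⟩)
    · rwa [hdP i t hc] at hy
    · exact hy
  obtain ⟨g, hinj, hgC, hadj, hK⟩ := hN.exists_copy C K Y (by
    intro y _ y' _ c hc hyy h1 h2
    rcases hC c hc with ⟨i, t, rfl⟩ | hc
    · rw [hKs] at h1 h2
      exact hN.triangle_free _ _ _ hyy h2 h1
    · rw [hKP _ _ hc] at h1 h2
      exact hN.triangle_free _ _ _ hyy h2 h1) (by
    intro y _ c hc c' hc' h1 h2 hcc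
    rcases hC c hc with ⟨i, t, rfl⟩ | hc <;> rcases hC c' hc' with ⟨i', t', rfl⟩ | hc'
    · rw [hKs] at h1 h2
      exact hN.triangle_free _ _ _ h1 (h.adj_of_adj hN hcc) h2
    · rw [hKs] at h1
      rw [hKP _ _ hc'] at h2
      exact hN.triangle_free _ _ _ h1 ((h.adj_iff i t _ hc').1 hcc) h2
    · rw [hKP _ _ hc] at h1
      rw [hKs] at h2
      exact hN.triangle_free _ _ _ h2 ((h.adj_iff i' t' _ hc).1 (hN.symm _ _ hcc)) h1
    · rw [hKP _ _ hc] at h1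
      rw [hKP _ _ hc'] at h2
      exact hN.triangle_free _ _ _ h1 hcc h2)
  have hY : ∀ l, a l ∉ P → a l ∈ Y := fun l hl => Finset.mem_filter.2 ⟨by simp, hl⟩
  have hCP : ∀ l, a l ∈ P → a l ∈ C := fun l hl =>
    Finset.mem_union_right _ (Finset.mem_filter.2 ⟨by simp, hl⟩)
  have hCs : ∀ i ∈ F, ∀ t, s i t ∈ C := fun i hi t =>
    Finset.mem_union_left _ (Finset.mem_biUnion.2 ⟨i, hi, by simp⟩)
  refine ⟨fun l => if a l ∈ P then a l else g (a l), fun i hi =>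
    hN.sameAtomic_elim (fun l l' => ?_) (h.sameAtomic i) fun l t => ?_⟩
  · by_cases hl : a l ∈ P <;> by_cases hl' : a l' ∈ P <;> simp only [hl, hl', if_true, if_false]
    · simp
    · refine ⟨iff_of_false (fun e => hgC _ (hY l' hl') (e ▸ hCP l hl)) fun e => hl' (e ▸ hl), ?_⟩
      rw [hN.adj_comm, hK _ (hY l' hl') _ (hCP l hl), hKP _ _ hl, hN.adj_comm]
    · refine ⟨iff_of_false (fun e => hgC _ (hY l hl) (e ▸ hCP l' hl')) fun e => hl (e ▸ hl'), ?_⟩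
      rw [hK _ (hY l hl) _ (hCP l' hl'), hKP _ _ hl']
    · exact ⟨⟨fun e => hinj (hY l hl) (hY l' hl') e, fun e => by rw [e]⟩,
        hadj _ (hY l hl) _ (hY l' hl')⟩
  · by_cases hl : a l ∈ P <;> simp only [hl, if_true, if_false]
    · refine ⟨⟨fun e => ?_, fun e => ?_⟩, ?_⟩
      · rw [e, hdP i t (e ▸ hl)]
      · rw [e, h.eq_of_mem i t (e ▸ hl)]
      · rw [hN.adj_comm, h.adj_iff i t _ hl, hN.adj_comm]
    · refine ⟨iff_of_false (fun e => hgC _ (hY l hl) (e ▸ hCs i hi t)) fun e => hl (had l t e), ?_⟩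
      rw [hK _ (hY l hl) _ (hCs i hi t), hKs]

end FreeSequence

/-- Sets which meet inside `M` only are Conant-independent in a generic triangle-free graph. -/
theorem IsGeneric.conantIndep_of_inter_subset (hN : IsGeneric N) {κ : Cardinal.{max u v}}
    (hsat : IsSaturated edgeLanguage.{u, v} N κ) (hκ : ℵ₀ < κ) (hM : #M < κ) {A B : Set N}
    (hAB : ∀ e ∈ A, e ∈ B → e ∈ M) : ConantIndep M A B := by
  classical
  rintro n k φ a c ha hc hφ ⟨r, l, ψ, d, hdiv, himp⟩
  -- By genericity `a` may be moved over `c` away from the parameters of the dividing formulas.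
  let P : Set N := (M : Set N) ∪ Set.range c
  let C : Finset N := Finset.univ.image c ∪
    Finset.univ.biUnion fun j : Fin r => Finset.univ.image (d j)
  have hcC : ∀ j, c j ∈ C := fun j => Finset.mem_union_left _ (by simp)
  have hcP : ∀ j, c j ∈ P := fun j => Or.inr ⟨j, rfl⟩
  obtain ⟨a', hfree⟩ := hN.exists_isFreeCopy P C a
  have hφ' : φ.Realize (Sum.elim a' c) := by
    refine (hN.realize_iff (hN.sameAtomic_elim hfree.sameAtomic (fun i j => ⟨Iff.rfl, Iff.rfl⟩)
      fun t j => ?_) φ).2 hφ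
    by_cases ht : a t ∈ P
    · rw [hfree.eq_of_mem t ht]
      exact ⟨Iff.rfl, Iff.rfl⟩
    · refine ⟨iff_of_false (fun e => hfree.notMem t ht (e ▸ hcC j))
        (fun e => ht (e ▸ hcP j)), ?_⟩
      rw [hfree.adj_iff t ht _ (hcC j)]
      exact and_iff_right (hcP j)
  obtain ⟨j, hj⟩ := himp a' hφ'
  have had : ∀ t t', a' t = d j t' → a' t ∈ (M : Set N) := by
    intro t t' e
    by_cases ht : a t ∈ P
    · rw [hfree.eq_of_mem t ht]
      rcases ht with ht | ⟨i, hi⟩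
      · exact ht
      · rcases hc i with h1 | h1
        · rwa [← hi]
        · exact hAB _ (ha t) (hi ▸ h1)
    · refine absurd ?_ (hfree.notMem t ht)
      rw [e]
      exact Finset.mem_union_right _ (Finset.mem_biUnion.2 ⟨j, Finset.mem_univ _, by simp⟩)
  obtain ⟨s, h0, hmor, hs⟩ := hN.exists_freeSequence hsat hκ hM (d j)
  obtain ⟨F, hF⟩ := hdiv j s hmor h0
  obtain ⟨b, hb⟩ := hs.exists_amalgam hN a' had F
  exact hF ⟨b, fun i hi => (hN.realize_iff (hb i hi) (ψ j)).2 hj⟩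

theorem IsGeneric.conantIndep_symm (hN : IsGeneric N) {κ : Cardinal.{max u v}}
    (hsat : IsSaturated edgeLanguage.{u, v} N κ) (hκ : ℵ₀ < κ) (hM : #M < κ) {A B : Set N}
    (h : ConantIndep M A B) : ConantIndep M B A :=
  hN.conantIndep_of_inter_subset hsat hκ hM fun _ hB hA => h.mem_of_mem hsat hκ hM hA hB

end GenericIndependence

/-! ### A generic triangle-free graph on the natural numbers -/

section HensonGraph

/-- The finite set of numbers below `n` that `n` codes: the candidate neighbours of `n` among the
smaller numbers. Every finite set is coded by arbitrarily large numbers. -/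
def coded (n : ℕ) : Finset ℕ :=
  ((Encodable.decode n.unpair.1 : Option (Finset ℕ)).getD ∅).filter (· < n)

theorem lt_of_mem_coded {m n : ℕ} (h : m ∈ coded n) : m < n :=
  (Finset.mem_filter.1 h).2

theorem coded_pair (A : Finset ℕ) {b : ℕ} (hb : ∀ a ∈ A, a < b) :
    coded (Nat.pair (Encodable.encode A) b) = A := by
  ext x
  simp only [coded, Nat.unpair_pair, Encodable.encodek, Option.getD_some, Finset.mem_filter,
    and_iff_left_iff_imp]
  exact fun hx => (hb x hx).trans_le (Nat.right_le_pair _ _)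

/-- The number `n` is admissible if its candidate neighbours form an independent set in the graph
on the numbers below `n`, in which `m` is joined to its own candidate neighbours if and only if it
is admissible. -/
def IsAdmissible (n : ℕ) : Prop :=
  ∀ m, m ∈ coded n → (∃ l ∈ coded n, l ∈ coded m) → ¬ IsAdmissible m
termination_by n
decreasing_by exact lt_of_mem_coded ‹_›

/-- Adjacency in the Henson graph: admissible numbers are joined to the smaller numbers that they
code. -/
def HensonAdj (m n : ℕ) : Prop :=
  (m ∈ coded n ∧ IsAdmissible n) ∨ (n ∈ coded m ∧ IsAdmissible m)

theorem not_isAdmissible_of_mem {l m n : ℕ} (hlm : l ∈ coded m) (hln : l ∈ coded n)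
    (hmn : m ∈ coded n) (hm : IsAdmissible m) : ¬ IsAdmissible n := by
  intro hn
  rw [IsAdmissible] at hn
  exact hn m hmn ⟨l, hln, hlm⟩ hm

theorem not_hensonAdj_of_triangle {x y z : ℕ} (hxy : HensonAdj x y) (hyz : HensonAdj y z) :
    ¬ HensonAdj x z := by
  intro hxz
  rcases hxy with ⟨h1, g1⟩ | ⟨h1, g1⟩ <;> rcases hyz with ⟨h2, g2⟩ | ⟨h2, g2⟩ <;>
    rcases hxz with ⟨h3, g3⟩ | ⟨h3, g3⟩
  · exact not_isAdmissible_of_mem h1 h3 h2 g1 g2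
  · have := lt_of_mem_coded h1
    have := lt_of_mem_coded h2
    have := lt_of_mem_coded h3
    omega
  · exact not_isAdmissible_of_mem h3 h1 h2 g3 g1
  · exact not_isAdmissible_of_mem h3 h2 h1 g3 g1
  · exact not_isAdmissible_of_mem h1 h2 h3 g1 g2
  · exact not_isAdmissible_of_mem h2 h1 h3 g2 g1
  · have := lt_of_mem_coded h1
    have := lt_of_mem_coded h2
    have := lt_of_mem_coded h3
    omega
  · exact not_isAdmissible_of_mem h2 h3 h1 g2 g1

/-- The Henson graph as a structure in the language of graphs. -/
instance hensonStructure : edgeLanguage.{u, v}.Structure (ULift.{max u v} ℕ) where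
  funMap f := f.elim
  RelMap R x := HensonAdj (x (Fin.cast R.down.down.symm 0)).down
    (x (Fin.cast R.down.down.symm 1)).down

theorem adj_henson {x y : ULift.{max u v} ℕ} :
    Adj.{u, v} x y ↔ HensonAdj x.down y.down := Iff.rfl

theorem isGeneric_henson : IsGeneric.{u, v} (ULift.{max u v} ℕ) where
  symm x y h := Or.symm h
  irrefl x h := by
    rcases h with ⟨h, -⟩ | ⟨h, -⟩ <;> exact (lt_of_mem_coded h).false
  triangle_free x y z h1 h2 := not_hensonAdj_of_triangle h1 h2
  extension A C hAC hA := by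
    classical
    set A' : Finset ℕ := A.image ULift.down with hA'
    obtain ⟨b, hb⟩ : ∃ b, ∀ c ∈ C, c.down < b :=
      ⟨C.sup ULift.down + 1, fun c hc => Nat.lt_succ_of_le (Finset.le_sup (f := ULift.down) hc)⟩
    have hcode := coded_pair A' (b := b) (by
      simp only [hA', Finset.mem_image]
      rintro _ ⟨a, ha, rfl⟩
      exact hb a (hAC ha))
    set z := Nat.pair (Encodable.encode A') b with hz
    have hlt : ∀ c ∈ C, c.down < z := fun c hc => (hb c hc).trans_le (Nat.right_le_pair _ _)
    have hadm : IsAdmissible z := by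
      rw [IsAdmissible, hcode]
      simp only [hA', Finset.mem_image]
      rintro _ ⟨m, hm, rfl⟩ ⟨_, ⟨l, hl, rfl⟩, hlm⟩ hgood
      exact hA m hm l hl (Or.inr ⟨hlm, hgood⟩)
    refine ⟨⟨z⟩, fun h => (hlt _ h).false, fun c hc => ?_⟩
    rw [adj_henson, HensonAdj, hcode]
    have hmem : c.down ∈ A' ↔ c ∈ A := by
      simp only [hA', Finset.mem_image]
      exact ⟨fun ⟨a, ha, h⟩ => ULift.down_injective h ▸ ha, fun h => ⟨c, h, rfl⟩⟩
    rw [hmem]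
    refine ⟨?_, fun h => Or.inr ⟨h, hadm⟩⟩
    rintro (⟨h, -⟩ | ⟨h, -⟩)
    · exact absurd (lt_of_mem_coded h) (hlt c hc).le.not_gt
    · exact h

end HensonGraph

section Transfer

universe w

variable {H N : Type w} [edgeLanguage.{u, v}.Structure H] [edgeLanguage.{u, v}.Structure N]

/-- Being a generic triangle-free graph is a first-order property. -/
theorem IsGeneric.of_elementarilyEquivalent (hH : IsGeneric H)
    (h : N ≅[edgeLanguage.{u, v}] H) : IsGeneric N where
  symm x y hxy := by
    by_contra hyx
    obtain ⟨b, hb⟩ := exists_realize_of_elementarilyEquivalent h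
      (adjFormula (0 : Fin 2) 1 ⊓ (adjFormula 1 0).not) ⟨![x, y], by simp [hxy, hyx]⟩
    simp only [Formula.realize_inf, Formula.realize_not, realize_adjFormula] at hb
    exact hb.2 (hH.symm _ _ hb.1)
  irrefl x hx := by
    obtain ⟨b, hb⟩ := exists_realize_of_elementarilyEquivalent h
      (adjFormula (0 : Fin 1) 0) ⟨![x], by simp [hx]⟩
    exact hH.irrefl _ ((realize_adjFormula _ _ _).1 hb)
  triangle_free x y z hxy hyz hxz := by
    obtain ⟨b, hb⟩ := exists_realize_of_elementarilyEquivalent h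
      (adjFormula (0 : Fin 3) 1 ⊓ (adjFormula 1 2 ⊓ adjFormula 0 2))
      ⟨![x, y, z], by simp [hxy, hyz, hxz]⟩
    simp only [Formula.realize_inf, realize_adjFormula] at hb
    exact hH.triangle_free _ _ _ hb.1 hb.2.1 hb.2.2
  extension A C hAC hA := by
    classical
    by_contra hno
    -- `θ` says that the variable `Sum.inr ()` is the required vertex over the variables in `C`.
    let θ : edgeLanguage.{u, v}.Formula (C ⊕ Unit) := Formula.iInf fun c : C =>
      (eqFormula (Sum.inr ()) (Sum.inl c)).not ⊓
        if c.1 ∈ A then adjFormula (Sum.inr ()) (Sum.inl c)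
        else (adjFormula (Sum.inr ()) (Sum.inl c)).not
    have hθ : ∀ (K : Type _) [edgeLanguage.{u, v}.Structure K] (b : C → K),
        (Formula.iExs Unit θ).Realize b ↔
          ∃ z, ∀ c : C, z ≠ b c ∧ (Adj z (b c) ↔ c.1 ∈ A) := by
      intro K _ b
      rw [Formula.realize_iExs]
      have key : ∀ i : Unit → K, θ.Realize (Sum.elim b i) ↔
          ∀ c : C, i () ≠ b c ∧ (Adj (i ()) (b c) ↔ c.1 ∈ A) := by
        intro i
        rw [Formula.realize_iInf]
        refine forall_congr' fun c => ?_
        by_cases hc : c.1 ∈ A <;> simp [hc]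
      exact ⟨fun ⟨i, hi⟩ => ⟨i (), (key i).1 hi⟩, fun ⟨z, hz⟩ => ⟨fun _ => z, (key _).2 hz⟩⟩
    have hθN := hθ N
    have hθH := hθ H
    obtain ⟨b, hb⟩ := exists_realize_of_elementarilyEquivalent h
      ((Formula.iInf fun q : {q : C × C // q.1 ≠ q.2} => (eqFormula q.1.1 q.1.2).not) ⊓
        ((Formula.iInf fun q : {q : C × C // q.1.1 ∈ A ∧ q.2.1 ∈ A} =>
          (adjFormula q.1.1 q.1.2).not) ⊓ (Formula.iExs Unit θ).not))
      ⟨fun c => c.1, by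
        rw [Formula.realize_inf, Formula.realize_inf, Formula.realize_iInf, Formula.realize_iInf,
          Formula.realize_not, hθN]
        refine ⟨fun q => ?_, fun q => ?_, ?_⟩
        · rw [Formula.realize_not, realize_eqFormula]
          exact fun e => q.2 (Subtype.ext e)
        · rw [Formula.realize_not, realize_adjFormula]
          exact hA _ q.2.1 _ q.2.2
        · rintro ⟨z, hz⟩
          exact hno ⟨z, fun hzC => (hz ⟨z, hzC⟩).1 rfl, fun c hc => (hz ⟨c, hc⟩).2⟩⟩
    rw [Formula.realize_inf, Formula.realize_inf, Formula.realize_iInf, Formula.realize_iInf,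
      Formula.realize_not, hθH] at hb
    obtain ⟨hinj, hind, hex⟩ := hb
    have hinj' : ∀ c d : C, b c = b d → c = d := by
      intro c d hcd
      by_contra hne
      have := hinj ⟨(c, d), hne⟩
      rw [Formula.realize_not, realize_eqFormula] at this
      exact this hcd
    have hmem : ∀ c : C, b c ∈ (Finset.univ.filter fun c : C => c.1 ∈ A).image b ↔ c.1 ∈ A := by
      intro c
      simp only [Finset.mem_image, Finset.mem_filter, Finset.mem_univ, true_and]
      exact ⟨fun ⟨d, hd, e⟩ => hinj' _ _ e ▸ hd, fun hc => ⟨c, hc, rfl⟩⟩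
    obtain ⟨z, hz, hadj⟩ := hH.extension ((Finset.univ.filter fun c : C => c.1 ∈ A).image b)
      (Finset.univ.image b) (Finset.image_subset_image (Finset.filter_subset _ _)) (by
        simp only [Finset.mem_image, Finset.mem_filter, Finset.mem_univ, true_and]
        rintro _ ⟨c, hc, rfl⟩ _ ⟨d, hd, rfl⟩
        have := hind ⟨(c, d), hc, hd⟩
        rwa [Formula.realize_not, realize_adjFormula] at this)
    refine hex ⟨z, fun c => ⟨fun e => hz (e ▸ Finset.mem_image_of_mem b (Finset.mem_univ c)), ?_⟩⟩
    rw [hadj _ (Finset.mem_image_of_mem b (Finset.mem_univ c)), hmem]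

end Transfer

section Properties

variable {N : Type*} [edgeLanguage.{u, v}.Structure N]

/-- In a generic triangle-free graph, fix pairwise non-adjacent vertices `p 0, p 1, p 2`, and let
the `i`-th entries of the triples in a sequence be adjacent to `p i` and to no other `p j`. Then the
`i`-th entries form an independent set, so the sequence can be prolonged by a triple whose
`(i + 1)`-st entry is adjacent to all earlier `i`-th entries. -/
theorem IsGeneric.exists_cyclic_sequence (hN : IsGeneric N) :
    ∃ a : ℕ → Fin 3 → N, ∀ m n, m < n → ∀ i, Adj (a m i) (a n (i + 1)) := by
  classical
  obtain ⟨p, -, hp⟩ := exists_seq_of_forall_finset_exists (fun _ : N => True)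
    (fun x y => x ≠ y ∧ ¬ Adj x y) (fun S _ => by
      obtain ⟨z, hz, hadj⟩ := hN.extension ∅ S (Finset.empty_subset _) (by simp)
      refine ⟨z, trivial, fun x hx => ⟨fun e => hz (e ▸ hx), fun hxz => ?_⟩⟩
      simpa using (hadj x hx).1 (hN.symm _ _ hxz))
  have hne : ∀ i j : ℕ, p i = p j → i = j := by
    intro i j e
    by_contra hij
    rcases lt_or_gt_of_ne hij with h | h
    · exact (hp _ _ h).1 e
    · exact (hp _ _ h).1 e.symm
  have hpp : ∀ i j : ℕ, ¬ Adj (p i) (p j) := by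
    intro i j e
    rcases lt_trichotomy i j with h | rfl | h
    · exact (hp _ _ h).2 e
    · exact hN.irrefl _ e
    · exact (hp _ _ h).2 (hN.symm _ _ e)
  obtain ⟨a, -, ha⟩ := exists_seq_of_forall_finset_exists
    (fun x : Fin 3 → N => ∀ i j : Fin 3, Adj (x i) (p j) ↔ j = i)
    (fun x y => ∀ i, Adj (x i) (y (i + 1))) (fun S hS => by
      have hstep : ∀ i : Fin 3, ∃ z, (∀ j : Fin 3, Adj z (p j) ↔ j = i + 1) ∧
          ∀ x ∈ S, Adj (x i) z := by
        intro i
        set A : Finset N := insert (p (i + 1 : Fin 3)) (S.image fun x => x i) with hA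
        set Q : Finset N := Finset.univ.image fun j : Fin 3 => p j
        have hAi : ∀ x ∈ A, ∀ y ∈ A, ¬ Adj x y := by
          have hxp : ∀ x ∈ S, ¬ Adj (x i) (p (i + 1 : Fin 3)) := by
            intro x hx h
            have := (hS x hx i (i + 1)).1 h
            simp at this
          simp only [hA, Finset.mem_insert, Finset.mem_image]
          rintro _ (rfl | ⟨x, hx, rfl⟩) _ (rfl | ⟨y, hy, rfl⟩) h
          · exact hpp _ _ h
          · exact hxp y hy (hN.symm _ _ h)
          · exact hxp x hx h
          · exact hN.triangle_free _ _ _ h ((hS y hy i i).2 rfl) ((hS x hx i i).2 rfl)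
        obtain ⟨z, -, hz⟩ := hN.extension A (A ∪ Q) Finset.subset_union_left hAi
        refine ⟨z, fun j => ?_, fun x hx => hN.symm _ _ ?_⟩
        · rw [hz _ (Finset.mem_union_right _ (Finset.mem_image_of_mem _ (Finset.mem_univ j))), hA,
            Finset.mem_insert, Finset.mem_image]
          constructor
          · rintro (h | ⟨x, hx, h⟩)
            · exact Fin.ext (hne _ _ h)
            · exact absurd (h ▸ (hS x hx i i).2 rfl) (hpp _ _)
          · rintro rfl
            exact Or.inl rfl
        · have hxA : x i ∈ A := Finset.mem_insert_of_mem (Finset.mem_image_of_mem _ hx)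
          exact (hz _ (Finset.mem_union_left _ hxA)).2 hxA
      choose z hz1 hz2 using hstep
      refine ⟨fun j => z (j - 1), fun i j => ?_, fun x hx i => ?_⟩
      · rw [hz1, sub_add_cancel]
      · simpa using hz2 i x hx)
  exact ⟨a, ha⟩

/-- The theory of the Henson graph. -/
def hensonTheory : edgeLanguage.{u, v}.Theory :=
  edgeLanguage.{u, v}.completeTheory (ULift.{max u v} ℕ)

theorem hensonTheory_isComplete : hensonTheory.{u, v}.IsComplete :=
  completeTheory.isComplete _ _

instance henson_models : ULift.{max u v} ℕ ⊨ hensonTheory.{u, v} :=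
  inferInstanceAs (ULift.{max u v} ℕ ⊨ edgeLanguage.{u, v}.completeTheory (ULift.{max u v} ℕ))

/-- The Henson graph as a model of its theory. -/
def hensonModel : Theory.ModelType.{u, v, max u v} hensonTheory.{u, v} :=
  Theory.ModelType.of _ (ULift.{max u v} ℕ)

theorem isGeneric_of_models (N : Theory.ModelType.{u, v, max u v} hensonTheory.{u, v}) :
    IsGeneric.{u, v} N :=
  IsGeneric.of_elementarilyEquivalent (H := hensonModel.{u, v}) isGeneric_henson.{u, v}
    (hensonTheory_isComplete.models_elementarily_equivalent _ _)

theorem hasSymmetricConantIndependence_hensonTheory :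
    HasSymmetricConantIndependence hensonTheory.{u, v} :=
  fun N _ hκ hsat _ hM _ _ _ _ h =>
    (isGeneric_of_models N).conantIndep_symm hsat ((le_max_right _ _).trans_lt hκ) hM h

/-- The witnessing relation holds between triples `x` and `y` if each `x i` is adjacent to
`y (i + 1)`; on a cycle of length three, the diagonal would be a triangle. -/
theorem hasSOPAddThree_hensonTheory : HasSOPAddThree hensonTheory.{u, v} 0 := by
  have hN : IsGeneric.{u, v} hensonModel.{u, v} := isGeneric_henson.{u, v}
  obtain ⟨a, ha⟩ := hN.exists_cyclic_sequence
  have hR : ∀ x y : Fin 3 → hensonModel.{u, v}, (Formula.iInf fun i : Fin 3 =>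
      adjFormula.{u, v} (Sum.inl i : Fin 3 ⊕ Fin 3) (Sum.inr (i + 1))).Realize (Sum.elim x y) ↔
        ∀ i, Adj (x i) (y (i + 1)) := by
    intro x y
    rw [Formula.realize_iInf]
    simp
  refine ⟨hensonModel, 3, _, ?_, a, fun i j hij => (hR _ _).2 (ha i j hij)⟩
  rintro ⟨x, hx⟩
  have h : ∀ i : Fin 3, Adj (x i i) (x (i + 1) (i + 1)) := fun i => (hR _ _).1 (hx i) i
  exact hN.triangle_free _ _ _ (h 0) (h 1) (hN.symm _ _ (h 2))

end Properties

end ConantIndependence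

/-! ### Symmetric Conant-independence and the `NSOP` hierarchy -/

open ConantIndependence in
theorem mainTheorem2 :
    (∀ (L : FirstOrder.Language.{u, v}) (T : L.Theory), T.IsComplete →
      ConantIndependence.HasSymmetricConantIndependence T → ConantIndependence.IsNSOP T 4) ∧
    IsGreatest {n : ℕ | ∃ (L : FirstOrder.Language.{u, v}) (T : L.Theory), T.IsComplete ∧
      ConantIndependence.IsStrictlyNSOP T n ∧
      ConantIndependence.HasSymmetricConantIndependence T} 4 := by
  refine ⟨fun L T _ hT => isNSOP_four_of_symmetric hT, ?_, ?_⟩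
  · refine ⟨edgeLanguage, hensonTheory, hensonTheory_isComplete, ⟨by norm_num, ?_, ?_⟩,
      hasSymmetricConantIndependence_hensonTheory⟩
    · exact isNSOP_four_of_symmetric hasSymmetricConantIndependence_hensonTheory
    · exact fun h => h hasSOPAddThree_hensonTheory
  · rintro n ⟨L, T, -, ⟨-, -, hn⟩, hT⟩
    by_contra! hlt
    obtain ⟨m, rfl⟩ := Nat.exists_eq_add_of_le hlt
    have hsop : HasSOP T (m + 4) := by
      have := not_not.1 hn
      rwa [show 4 + 1 + m - 1 = m + 4 by omega] at this
    exact isNSOP_four_of_symmetric hT (HasSOPAddThree.of_le (Nat.le_add_left 1 m) hsop)
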